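/- Let $S\subset\mathbb{CP}^n$ be a smooth, strongly $\mathbb C$-convex real hypersurface, that is, a smooth (embedded, not necessarily compact) real hypersurface that is locally projectively equivalent to a strongly convex hypersurface in an affine chart $\mathbb C^n$. Let $J$ be the complex structure tensor of $\mathbb{CP}^n$ and let $H_pS=T_pS\cap JT_pS$ be the maximal complex subspace of $T_pS$. Then $S$ carries a unique projective dual CR structure with maximal complex subspaces $H_pS$, that is, there are unique real-linear maps $J^*\colon H_pS\to H_pS$ ($p\in S$) with $(J^*)^2=-1$ such that, for all $p\in S$ and all affine coordinates $z_1,\dots,z_n$ around $p$ (obtained from arbitrary homogeneous coordinates on $\mathbb{CP}^n$) for which the complex tangent hyperplane of $S$ at $p$ does not pass through the origin, the functions $$w_j(z)=\frac{\partial\rho/\partial z_j}{z_1\,\partial\rho/\partial z_1+\dots+z_n\,\partial\rho/\partial z_n}\qquad(j=1,\dots,n)$$ satisfy $dw_j(J^*v)=i\,dw_j(v)$ for all $v\in H_pS$, where $\rho$ is any local defining function of $S$ near $p$. A degree-one $H$-form on $S$ is a smoothly varying family of real-linear maps $H_pS\to\mathbb C$ $(p\in S)$. For every smooth function $u\colon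 S\to\mathbb C$ there are uniquely determined degree-one $H$-forms $d'u$ and $d''u$ such that - $du|_H=d'u+d''u$; - $d'u$ is $\mathbb C$-linear with respect to the standard CR structure on $S$, i.e. $d'u(Jv)=i\,d'u(v)$ for $v\in H_pS$, $p\in S$; - $d''u$ is $\mathbb C$-linear with respect to the projective dual CR structure on $S$, i.e. $d''u(J^*v)=i\,d''u(v)$ for $v\in H_pS$, $p\in S$. The operators $u\mapsto d'u$ and $u\mapsto d''u$ are $\mathbb C$-linear. -/

import Mathlib

open Set Filter Topology
open scoped Manifold ContDiff LinearAlgebra.Projectivization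

noncomputable section

namespace ProjectiveDual

/-! ### Complex projective space as a manifold -/

/-- The model space `ℂⁿ`. -/
abbrev Cn (n : ℕ) : Type := Fin n → ℂ

/-- The space `ℂⁿ⁺¹` of homogeneous coordinates. -/
abbrev Cn1 (n : ℕ) : Type := Fin (n + 1) → ℂ

/-- Complex projective space `ℂℙⁿ`. -/
abbrev CP (n : ℕ) : Type := ℙ ℂ (Cn1 n)

variable {n : ℕ}

/-- The quotient topology on `ℂℙⁿ`. -/
instance instTopologicalSpaceCP : TopologicalSpace (CP n) :=
  TopologicalSpace.coinduced (Projectivization.mk' ℂ) inferInstance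

theorem continuous_mk' : Continuous (Projectivization.mk' ℂ : {v : Cn1 n // v ≠ 0} → CP n) :=
  continuous_coinduced_rng

theorem isOpen_iff_mk' {U : Set (CP n)} :
    IsOpen U ↔ IsOpen ((Projectivization.mk' ℂ : {v : Cn1 n // v ≠ 0} → CP n) ⁻¹' U) :=
  isOpen_coinduced

/-- A linear automorphism `g` of `ℂⁿ⁺¹` is regarded as a system of homogeneous coordinates:
the point `[Z]` has homogeneous coordinates `(gZ)₀ : ⋯ : (gZ)ₙ`. These are the affine coordinates
`(gZ)ⱼ / (gZ)₀`, `j = 1, …, n`. -/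
def affineCoord (g : Cn1 n ≃ₗ[ℂ] Cn1 n) (q : CP n) : Cn n :=
  fun j => g q.rep j.succ / g q.rep 0

/-- The domain `(gZ)₀ ≠ 0` of the affine coordinates. -/
def affineDomain (g : Cn1 n ≃ₗ[ℂ] Cn1 n) : Set (CP n) := {q | g q.rep 0 ≠ 0}

theorem cons_one_ne_zero (z : Cn n) : (Fin.cons 1 z : Cn1 n) ≠ 0 := fun h => by
  simpa using congrFun h 0

/-- The point with affine coordinates `z`. -/
def affinePoint (g : Cn1 n ≃ₗ[ℂ] Cn1 n) (z : Cn n) : CP n :=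
  Projectivization.mk ℂ (g.symm (Fin.cons 1 z : Cn1 n))
    (fun h => cons_one_ne_zero z (by simpa using h))

theorem affineCoord_mk (g : Cn1 n ≃ₗ[ℂ] Cn1 n) (v : Cn1 n) (hv : v ≠ 0) :
    affineCoord g (Projectivization.mk ℂ v hv) = fun j => g v j.succ / g v 0 := by
  obtain ⟨a, ha⟩ := Projectivization.exists_smul_eq_mk_rep ℂ v hv
  funext j
  have h0 : (a : ℂ) ≠ 0 := a.ne_zero
  simp only [affineCoord, ← ha, Units.smul_def, map_smul, Pi.smul_apply, smul_eq_mul]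
  rw [mul_div_mul_left _ _ h0]

theorem mk_mem_affineDomain (g : Cn1 n ≃ₗ[ℂ] Cn1 n) (v : Cn1 n) (hv : v ≠ 0) :
    Projectivization.mk ℂ v hv ∈ affineDomain g ↔ g v 0 ≠ 0 := by
  obtain ⟨a, ha⟩ := Projectivization.exists_smul_eq_mk_rep ℂ v hv
  simp [affineDomain, ← ha, Units.smul_def]

theorem continuous_coeff (g : Cn1 n ≃ₗ[ℂ] Cn1 n) (i : Fin (n + 1)) :
    Continuous fun v : Cn1 n => g v i :=
  (continuous_apply i).comp (LinearMap.continuous_of_finiteDimensional g.toLinearMap)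

theorem isOpen_affineDomain (g : Cn1 n ≃ₗ[ℂ] Cn1 n) : IsOpen (affineDomain g) := by
  rw [isOpen_iff_mk']
  have : (Projectivization.mk' ℂ : {v : Cn1 n // v ≠ 0} → CP n) ⁻¹' affineDomain g
      = {v | g v.1 0 ≠ 0} := by
    ext v
    exact mk_mem_affineDomain g v.1 v.2
  rw [this]
  exact isOpen_ne_fun ((continuous_coeff g 0).comp continuous_subtype_val) continuous_const

theorem affineCoord_affinePoint (g : Cn1 n ≃ₗ[ℂ] Cn1 n) (z : Cn n) :
    affineCoord g (affinePoint g z) = z := by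
  rw [affinePoint, affineCoord_mk]
  funext j
  simp

theorem affinePoint_mem (g : Cn1 n ≃ₗ[ℂ] Cn1 n) (z : Cn n) :
    affinePoint g z ∈ affineDomain g := by
  rw [affinePoint, mk_mem_affineDomain]
  simp

theorem affinePoint_affineCoord (g : Cn1 n ≃ₗ[ℂ] Cn1 n) (q : CP n) (hq : q ∈ affineDomain g) :
    affinePoint g (affineCoord g q) = q := by
  have hq' : g q.rep 0 ≠ 0 := hq
  conv_rhs => rw [← q.mk_rep]
  rw [affinePoint, Projectivization.mk_eq_mk_iff']
  refine ⟨(g q.rep 0)⁻¹, ?_⟩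
  rw [LinearEquiv.eq_symm_apply, map_smul]
  funext i
  refine Fin.cases ?_ (fun j => ?_) i
  · simp [hq']
  · simp [affineCoord, div_eq_inv_mul]

theorem continuous_affinePoint (g : Cn1 n ≃ₗ[ℂ] Cn1 n) : Continuous (affinePoint g) := by
  have h : Continuous fun z : Cn n => g.symm (Fin.cons 1 z : Cn1 n) := by
    refine (LinearMap.continuous_of_finiteDimensional g.symm.toLinearMap).comp ?_
    refine continuous_pi fun i => ?_
    refine Fin.cases ?_ (fun j => ?_) i
    · simpa using continuous_const
    · simpa using continuous_apply j
  exact continuous_mk'.comp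
    (h.subtype_mk (fun z hz => cons_one_ne_zero z (by simpa using hz)))

theorem continuousOn_affineCoord (g : Cn1 n ≃ₗ[ℂ] Cn1 n) :
    ContinuousOn (affineCoord g) (affineDomain g) := by
  rw [(isOpen_affineDomain g).continuousOn_iff]
  intro q
  refine Projectivization.ind (fun v hv => ?_) q
  · intro hq s hs
    rw [Filter.mem_map]
    have hc : ContinuousAt
        (fun w : {v : Cn1 n // v ≠ 0} => (fun j => g w.1 j.succ / g w.1 0 : Cn n)) ⟨v, hv⟩ := by
      refine continuousAt_pi.2 fun j => ?_
      exact ((continuous_coeff g j.succ).comp continuous_subtype_val).continuousAt.div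
        ((continuous_coeff g 0).comp continuous_subtype_val).continuousAt
        ((mk_mem_affineDomain g v hv).1 hq)
    rw [affineCoord_mk] at hs
    obtain ⟨t, ht, hto, hvt⟩ := _root_.mem_nhds_iff.1 (hc hs)
    have hopen : IsOpen ((Projectivization.mk' ℂ : {v : Cn1 n // v ≠ 0} → CP n) '' t) := by
      rw [isOpen_iff_mk']
      have : (Projectivization.mk' ℂ : {v : Cn1 n // v ≠ 0} → CP n) ⁻¹'
          ((Projectivization.mk' ℂ : {v : Cn1 n // v ≠ 0} → CP n) '' t)
          = ⋃ a : ℂˣ, (fun w : {v : Cn1 n // v ≠ 0} =>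
              (⟨(a : ℂ) • w.1, smul_ne_zero a.ne_zero w.2⟩ : {v : Cn1 n // v ≠ 0})) ⁻¹' t := by
        ext w
        simp only [mem_preimage, mem_image, mem_iUnion]
        constructor
        · rintro ⟨x, hx, hxw⟩
          obtain ⟨a, ha⟩ := (Projectivization.mk_eq_mk_iff ℂ x.1 w.1 x.2 w.2).1 hxw
          refine ⟨a, ?_⟩
          have : (⟨(a : ℂ) • w.1, smul_ne_zero a.ne_zero w.2⟩ : {v : Cn1 n // v ≠ 0}) = x :=
            Subtype.ext ha
          rwa [this]
        · rintro ⟨a, ha⟩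
          exact ⟨_, ha, (Projectivization.mk_eq_mk_iff ℂ _ _ _ _).2 ⟨a, rfl⟩⟩
      rw [this]
      refine isOpen_iUnion fun a => hto.preimage ?_
      exact (continuous_subtype_val.const_smul (a : ℂ)).subtype_mk _
    refine Filter.mem_of_superset (hopen.mem_nhds ⟨⟨v, hv⟩, hvt, rfl⟩) ?_
    rintro _ ⟨w, hw, rfl⟩
    have := ht hw
    rw [mem_preimage, Projectivization.mk'_eq_mk, affineCoord_mk]
    exact this

/-- The affine chart of `ℂℙⁿ` belonging to a system of homogeneous coordinates. -/
def affineChart (g : Cn1 n ≃ₗ[ℂ] Cn1 n) : OpenPartialHomeomorph (CP n) (Cn n) where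
  toFun := affineCoord g
  invFun := affinePoint g
  source := affineDomain g
  target := univ
  map_source' _ _ := mem_univ _
  map_target' z _ := affinePoint_mem g z
  left_inv' q hq := affinePoint_affineCoord g q hq
  right_inv' z _ := affineCoord_affinePoint g z
  open_source := isOpen_affineDomain g
  open_target := isOpen_univ
  continuousOn_toFun := continuousOn_affineCoord g
  continuousOn_invFun := (continuous_affinePoint g).continuousOn

theorem exists_mem_affineDomain (q : CP n) :
    ∃ g : Cn1 n ≃ₗ[ℂ] Cn1 n, q ∈ affineDomain g := by
  obtain ⟨i, hi⟩ := Function.ne_iff.1 q.rep_nonzero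
  exact ⟨LinearEquiv.funCongrLeft ℂ ℂ (Equiv.swap 0 i), by
    simpa [affineDomain, LinearEquiv.funCongrLeft_apply, LinearMap.funLeft_apply] using hi⟩

/-- `ℂℙⁿ` with the atlas of all affine charts. -/
instance instChartedSpaceCP : ChartedSpace (Cn n) (CP n) where
  atlas := range affineChart
  chartAt q := affineChart (exists_mem_affineDomain q).choose
  mem_chart_source q := (exists_mem_affineDomain q).choose_spec
  chart_mem_atlas _ := mem_range_self _

theorem contDiffOn_transition {𝕜 : Type*} [NontriviallyNormedField 𝕜] [NormedAlgebra 𝕜 ℂ]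
    (m : WithTop ℕ∞) (g h : Cn1 n ≃ₗ[ℂ] Cn1 n) :
    ContDiffOn 𝕜 m (fun z => affineCoord h (affinePoint g z))
      {z | affinePoint g z ∈ affineDomain h} := by
  have hc : ∀ i, ContDiff 𝕜 m fun z : Cn n => h (g.symm (Fin.cons 1 z : Cn1 n)) i := by
    intro i
    have h1 : ContDiff 𝕜 m fun z : Cn n => (Fin.cons 1 z : Cn1 n) := by
      refine contDiff_pi.2 fun k => ?_
      refine Fin.cases ?_ (fun j => ?_) k
      · simpa using contDiff_const
      · simpa using contDiff_apply 𝕜 ℂ j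
    have h2 : ContDiff 𝕜 m fun w : Cn1 n => h (g.symm w) i :=
      (((LinearMap.toContinuousLinearMap
        ((LinearMap.proj i).comp (h.toLinearMap.comp g.symm.toLinearMap) :
          Cn1 n →ₗ[ℂ] ℂ)).restrictScalars 𝕜)).contDiff
    exact h2.comp h1
  have : (fun z => affineCoord h (affinePoint g z)) = fun z (j : Fin n) =>
      h (g.symm (Fin.cons 1 z : Cn1 n)) j.succ / h (g.symm (Fin.cons 1 z : Cn1 n)) 0 := by
    funext z
    rw [affinePoint, affineCoord_mk]
  rw [this]
  refine contDiffOn_pi.2 fun j => ?_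
  simp only [div_eq_mul_inv]
  refine (hc j.succ).contDiffOn.mul ((hc 0).contDiffOn.inv fun z hz => ?_)
  exact (mk_mem_affineDomain h _ _).1 hz

/-- `ℂℙⁿ` is a complex manifold. -/
instance instIsManifoldComplexCP : IsManifold 𝓘(ℂ, Cn n) ω (CP n) := by
  refine isManifold_of_contDiffOn _ _ _ ?_
  rintro _ _ ⟨g, rfl⟩ ⟨h, rfl⟩
  simpa [affineChart, preimage, Function.comp_def] using contDiffOn_transition (𝕜 := ℂ) ω g h

/-- `ℂℙⁿ` is a smooth real manifold. -/
instance instIsManifoldRealCP : IsManifold 𝓘(ℝ, Cn n) ∞ (CP n) := by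
  refine isManifold_of_contDiffOn _ _ _ ?_
  rintro _ _ ⟨g, rfl⟩ ⟨h, rfl⟩
  simpa [affineChart, preimage, Function.comp_def] using contDiffOn_transition (𝕜 := ℝ) ∞ g h

/-- The real tangent space `T_p ℂℙⁿ`. -/
abbrev TCP (p : CP n) : Type := TangentSpace 𝓘(ℝ, Cn n) p

/-- The complex structure tensor `J` of `ℂℙⁿ`. The tangent space at `p` is the model space `ℂⁿ`
by means of a holomorphic chart around `p`, and `J` is the multiplication by `i`. -/
def J (p : CP n) : TCP p →ₗ[ℝ] TCP p :=
  (Complex.I • LinearMap.id : Cn n →ₗ[ℝ] Cn n)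

theorem J_J (p : CP n) (v : TCP p) : J p (J p v) = -v := by
  change Complex.I • Complex.I • (show Cn n from v) = -(show Cn n from v)
  rw [smul_smul, Complex.I_mul_I, neg_one_smul]

/-! ### Real hypersurfaces and their maximal complex subspaces -/

/-- `ρ` is a smooth local defining function of `S` around `p`. -/
def IsLocalDefiningFunction (S : Set (CP n)) (p : CP n) (ρ : CP n → ℝ) : Prop :=
  ∃ U : Set (CP n), IsOpen U ∧ p ∈ U ∧ ContMDiffOn 𝓘(ℝ, Cn n) 𝓘(ℝ, ℝ) ∞ ρ U ∧
    (∀ q ∈ U, q ∈ S ↔ ρ q = 0) ∧ mfderiv 𝓘(ℝ, Cn n) 𝓘(ℝ, ℝ) ρ p ≠ 0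

/-- Smooth (embedded, not necessarily closed or compact) real hypersurfaces in `ℂℙⁿ`. -/
def IsSmoothHypersurface (S : Set (CP n)) : Prop :=
  ∀ p ∈ S, ∃ ρ : CP n → ℝ, IsLocalDefiningFunction S p ρ

/-- Strongly convex smooth real hypersurfaces in affine space `ℂⁿ = ℝ²ⁿ`: they have local defining
functions whose real Hessian is positive definite on the tangent space. -/
def IsStronglyConvexHypersurface (M : Set (Cn n)) : Prop :=
  ∀ z ∈ M, ∃ (r : Cn n → ℝ) (U : Set (Cn n)), IsOpen U ∧ z ∈ U ∧ ContDiffOn ℝ ∞ r U ∧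
    (∀ y ∈ U, y ∈ M ↔ r y = 0) ∧ fderiv ℝ r z ≠ 0 ∧
    ∀ v : Cn n, fderiv ℝ r z v = 0 → v ≠ 0 → 0 < fderiv ℝ (fderiv ℝ r) z v v

/-- Strongly `ℂ`-convex hypersurfaces: smooth real hypersurfaces in `ℂℙⁿ` that are locally
projectively equivalent to a strongly convex hypersurface. -/
def IsStronglyCConvex (S : Set (CP n)) : Prop :=
  IsSmoothHypersurface S ∧
    ∀ p ∈ S, ∃ (g : Cn1 n ≃ₗ[ℂ] Cn1 n) (W : Set (CP n)), IsOpen W ∧ p ∈ W ∧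
      W ⊆ affineDomain g ∧ IsStronglyConvexHypersurface (affineChart g '' (S ∩ W))

/-- The tangent space `T_p S`: the common kernel of the differentials at `p` of the local defining
functions (which are all proportional to each other). -/
def tangentSpaceOf (S : Set (CP n)) (p : CP n) : Submodule ℝ (TCP p) where
  carrier := {v | ∀ ρ : CP n → ℝ, IsLocalDefiningFunction S p ρ →
    mfderiv 𝓘(ℝ, Cn n) 𝓘(ℝ, ℝ) ρ p v = 0}
  zero_mem' ρ _ := map_zero (mfderiv 𝓘(ℝ, Cn n) 𝓘(ℝ, ℝ) ρ p)
  add_mem' {v w} hv hw ρ hρ := by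
    have h := map_add (mfderiv 𝓘(ℝ, Cn n) 𝓘(ℝ, ℝ) ρ p) v w
    rw [hv ρ hρ, hw ρ hρ] at h
    simpa using h
  smul_mem' c v hv ρ hρ := by
    have h := map_smul (mfderiv 𝓘(ℝ, Cn n) 𝓘(ℝ, ℝ) ρ p) c v
    rw [hv ρ hρ] at h
    simpa using h

/-- The maximal complex subspace `H_p S = T_p S ∩ J T_p S`. -/
def H (S : Set (CP n)) (p : CP n) : Submodule ℝ (TCP p) :=
  tangentSpaceOf S p ⊓ (tangentSpaceOf S p).map (J p)

theorem J_mem_H {S : Set (CP n)} {p : CP n} {v : TCP p} (hv : v ∈ H S p) : J p v ∈ H S p := by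
  obtain ⟨h1, w, hw, rfl⟩ := hv
  refine ⟨?_, Submodule.mem_map_of_mem h1⟩
  rw [J_J]
  exact neg_mem hw

/-- The standard complex structure tensor `J : H_p S → H_p S`. -/
def JH (S : Set (CP n)) (p : CP n) : H S p →ₗ[ℝ] H S p :=
  (J p).restrict fun _ hv => J_mem_H hv

/-! ### The projective dual CR structure -/

/-- The Wirtinger derivative `∂r/∂zⱼ`. -/
def wirtinger (r : Cn n → ℝ) (j : Fin n) (z : Cn n) : ℂ :=
  ((fderiv ℝ r z (Pi.single j 1) : ℂ) - Complex.I * (fderiv ℝ r z (Pi.single j Complex.I) : ℂ)) / 2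

/-- The sum `z₁ ∂r/∂z₁ + ⋯ + zₙ ∂r/∂zₙ`. If `z` is a point of the hypersurface `r = 0`, it is
nonzero if and only if the complex tangent hyperplane at `z` does not pass through the origin. -/
def denom (r : Cn n → ℝ) (z : Cn n) : ℂ := ∑ k, z k * wirtinger r k z

/-- The functions `wⱼ` in terms of affine coordinates. -/
def dualCoord (r : Cn n → ℝ) (j : Fin n) (z : Cn n) : ℂ := wirtinger r j z / denom r z

/-- The functions `wⱼ` belonging to the function `ρ` and to a system of affine coordinates,
as functions on `ℂℙⁿ`. -/
def w (g : Cn1 n ≃ₗ[ℂ] Cn1 n) (ρ : CP n → ℝ) (j : Fin n) (q : CP n) : ℂ :=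
  dualCoord (ρ ∘ affinePoint g) j (affineCoord g q)

/-- The differential at `p` of a complex function `f` on `ℂℙⁿ`. -/
def differential (f : CP n → ℂ) (p : CP n) : TCP p →ₗ[ℝ] ℂ :=
  (mfderiv 𝓘(ℝ, Cn n) 𝓘(ℝ, ℂ) f p).toLinearMap

/-- `Jst` is the tensor of the projective dual CR structure of `S`, whose maximal complex subspaces
are the spaces `H_p S`: an almost complex structure on `H S` with respect to which the functions
`wⱼ` are CR, for all affine coordinates around `p` for which the complex tangent hyperplane of
`S` at `p` does not pass through the origin. -/
def IsProjectiveDualStructure (S : Set (CP n)) (Jst : ∀ p : S, H S p →ₗ[ℝ] H S p) : Prop :=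
  ∀ p : S, (∀ v, Jst p (Jst p v) = -v) ∧
    ∀ (g : Cn1 n ≃ₗ[ℂ] Cn1 n) (ρ : CP n → ℝ), (p : CP n) ∈ affineDomain g →
      IsLocalDefiningFunction S p ρ → denom (ρ ∘ affinePoint g) (affineCoord g p) ≠ 0 →
      ∀ (j : Fin n) (v : H S p),
        differential (w g ρ j) p (Jst p v) = Complex.I * differential (w g ρ j) p v

/-! ### Smooth functions and `H`-forms on a hypersurface -/

/-- `U` is a neighborhood of `p` and `f` is a smooth function on `U` with `f = u` on `S ∩ U`. -/
def IsLocalExtension (S : Set (CP n)) (u : S → ℂ) (p : CP n) (U : Set (CP n)) (f : CP n → ℂ) :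
    Prop :=
  IsOpen U ∧ p ∈ U ∧ ContMDiffOn 𝓘(ℝ, Cn n) 𝓘(ℝ, ℂ) ∞ f U ∧ ∀ q : S, (q : CP n) ∈ U → f q = u q

/-- The space of smooth functions `S → ℂ`. -/
def SmoothFunctions (S : Set (CP n)) : Submodule ℂ (S → ℂ) where
  carrier := {u | ∀ p : S, ∃ U f, IsLocalExtension S u p U f}
  zero_mem' p := ⟨univ, fun _ => 0, isOpen_univ, mem_univ _, contMDiffOn_const, fun _ _ => rfl⟩
  add_mem' {u v} hu hv p := by
    obtain ⟨U, f, hU, hpU, hf, hfu⟩ := hu p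
    obtain ⟨V, g, hV, hpV, hg, hgv⟩ := hv p
    exact ⟨U ∩ V, fun q => f q + g q, hU.inter hV, ⟨hpU, hpV⟩,
      (hf.mono inter_subset_left).add (hg.mono inter_subset_right),
      fun q hq => by simp [hfu q hq.1, hgv q hq.2]⟩
  smul_mem' c u hu p := by
    obtain ⟨U, f, hU, hpU, hf, hfu⟩ := hu p
    exact ⟨U, fun q => c • f q, hU, hpU, (contDiff_id.const_smul c : ContDiff ℝ ∞ fun x : ℂ => c • x).contMDiff.comp_contMDiffOn hf,
      fun q hq => by simp [hfu q hq]⟩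

/-- The differential `dz` at `q` of the affine coordinates. -/
def coordDifferential (g : Cn1 n ≃ₗ[ℂ] Cn1 n) (q : CP n) : TCP q →ₗ[ℝ] Cn n :=
  (mfderiv 𝓘(ℝ, Cn n) 𝓘(ℝ, Cn n) (affineCoord g) q).toLinearMap

/-- The space of `H`-forms of degree one on `S`: families of real-linear maps `H_p S → ℂ` that vary
smoothly, that is, that are locally the restrictions of a 1-form `∑ (aⱼ dxⱼ + bⱼ dyⱼ)` with smooth
complex coefficients, in affine coordinates `zⱼ = xⱼ + i yⱼ`. -/
def HForms (S : Set (CP n)) : Submodule ℂ (∀ p : S, H S p →ₗ[ℝ] ℂ) where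
  carrier := {α | ∀ (p : S) (g : Cn1 n ≃ₗ[ℂ] Cn1 n), (p : CP n) ∈ affineDomain g →
    ∃ (U : Set (CP n)) (a : CP n → (Cn n →L[ℝ] ℂ)), IsOpen U ∧ (p : CP n) ∈ U ∧
      U ⊆ affineDomain g ∧ ContMDiffOn 𝓘(ℝ, Cn n) 𝓘(ℝ, Cn n →L[ℝ] ℂ) ∞ a U ∧
      ∀ q : S, (q : CP n) ∈ U → ∀ v : H S q,
        α q v = a q (coordDifferential g q v)}
  zero_mem' p g hp := ⟨affineDomain g, fun _ => 0, isOpen_affineDomain g, hp, subset_rfl,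
    contMDiffOn_const, fun _ _ _ => rfl⟩
  add_mem' {α β} hα hβ p g hp := by
    obtain ⟨U, a, hU, hpU, hUg, ha, haα⟩ := hα p g hp
    obtain ⟨V, b, hV, hpV, -, hb, hbβ⟩ := hβ p g hp
    exact ⟨U ∩ V, fun q => a q + b q, hU.inter hV, ⟨hpU, hpV⟩, inter_subset_left.trans hUg,
      (ha.mono inter_subset_left).add (hb.mono inter_subset_right),
      fun q hq v => by
        simp only [Pi.add_apply, LinearMap.add_apply]
        rw [haα q hq.1 v, hbβ q hq.2 v]
        rfl⟩
  smul_mem' c α hα p g hp := by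
    obtain ⟨U, a, hU, hpU, hUg, ha, haα⟩ := hα p g hp
    exact ⟨U, fun q => c • a q, hU, hpU, hUg,
      (contDiff_id.const_smul c : ContDiff ℝ ∞ fun x : Cn n →L[ℝ] ℂ => c • x).contMDiff.comp_contMDiffOn
        ha,
      fun q hq v => by
        simp only [Pi.smul_apply, LinearMap.smul_apply]
        rw [haα q hq v]
        rfl⟩

/-- `α` is the restriction `du|_H` of the differential of `u` to `H S`. -/
def IsDifferentialOnH (S : Set (CP n)) (u : S → ℂ) (α : ∀ p : S, H S p →ₗ[ℝ] ℂ) : Prop :=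
  ∀ (p : S) (U : Set (CP n)) (f : CP n → ℂ), IsLocalExtension S u p U f →
    ∀ v : H S p, α p v = differential f p v

/-- `α` is `ℂ`-linear with respect to the tensor `K` on `H S`. -/
def IsLinearWrt {S : Set (CP n)} (K : ∀ p : S, H S p →ₗ[ℝ] H S p)
    (α : ∀ p : S, H S p →ₗ[ℝ] ℂ) : Prop :=
  ∀ (p : S) (v : H S p), α p (K p v) = Complex.I * α p v

/-- `du|_H = α + β`, where `α` is `ℂ`-linear with respect to the standard CR structure and `β` is
`ℂ`-linear with respect to the CR structure with tensor `Jst`. -/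
def IsDecomposition {S : Set (CP n)} (Jst : ∀ p : S, H S p →ₗ[ℝ] H S p)
    (u : SmoothFunctions S) (α β : HForms S) : Prop :=
  IsDifferentialOnH S u ((α + β : HForms S) : ∀ p : S, H S p →ₗ[ℝ] ℂ) ∧
    IsLinearWrt (fun p : S => JH S p) (α : ∀ p : S, H S p →ₗ[ℝ] ℂ) ∧
    IsLinearWrt Jst (β : ∀ p : S, H S p →ₗ[ℝ] ℂ)

end ProjectiveDual

end

/-!
In affine coordinates around `p`, let `r` be a local defining function of `S`, and let `h` be its
real Hessian, restricted to the maximal complex subspace `H_p S`. Everything rests on a description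
of `J*` by `h`: the condition `dwⱼ(x) = i dwⱼ(v)` for all `j` is equivalent to `h(x, u) = h(v, J u)`
for all `u ∈ H_p S` (`fderiv_dualCoord_eq_I_mul_iff`). So `J*` has to be the adjoint of `J` with
respect to `h`.

The form `h` on `H_p S` is independent, up to a nonzero real factor, of the defining function and of
the coordinates (`exists_chartHessian_eq_mul`). For two defining functions one compares second
derivatives along curves in `S` (`derivs_of_vanishing`). A change of affine coordinates maps lines
into complex lines with the same tangent (`exists_reparametrization`), so that it alters `h(v, v)`
only by the value of `dr` at a complex multiple of `v ∈ H_p S`, which is zero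
(`chartHessian_change`). In suitable coordinates `S` is strongly convex, hence `h` is definite. The
adjoint `J*` therefore exists and is unique, `(J*)² = -1` follows from `J² = -1`, and the adjoint
is the same for all choices.

If `J v = J* v`, then `h(J v, J v) = h(J* v, J v) = -h(v, v)`, so `v = 0` and `J - J*` is invertible
on `H_p S`. With `γ = du|_H`, the equations `γ = α + β`, `α ∘ J = i α`, `β ∘ J* = i β` give
`β ∘ (J - J*) = γ ∘ J - i γ`. This proves uniqueness, and
`β = (γ ∘ J - i γ) ∘ (J - J*)⁻¹` solves the equations (`decomposition_unique`, `exists_dualPart`).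

For smoothness of `β`, note that `k = (J - J*)⁻¹ x` is characterized by
`h(x, u) = h(J k, u) - h(k, J u)` for all `u ∈ H_p S`. Via a smooth projection of `ℂⁿ` onto the
maximal complex subspaces, the right hand side is extended to a nondegenerate bilinear form on
`ℂⁿ` with smooth coefficients, which can be inverted smoothly (`exists_smooth_solution`).
-/

noncomputable section

namespace ProjectiveDual

/-! ### Second-order calculus along curves in a zero set -/

section Calculus

variable {E : Type*} [NormedAddCommGroup E] [NormedSpace ℝ E]

theorem differentiableAt_fderiv {F : Type*} [NormedAddCommGroup F] [NormedSpace ℝ F]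
    {r : E → F} {z : E} (hr : ContDiffAt ℝ 2 r z) : DifferentiableAt ℝ (fderiv ℝ r) z :=
  (hr.fderiv_right (m := 1) (by norm_num)).differentiableAt (by norm_num)

theorem hessian_symm {r : E → ℝ} {z : E} (hr : ContDiffAt ℝ 2 r z) (u v : E) :
    fderiv ℝ (fderiv ℝ r) z u v = fderiv ℝ (fderiv ℝ r) z v u :=
  hr.isSymmSndFDerivAt (by simp) u v

theorem differentiableAt_deriv {c : ℝ → E} {t : ℝ} (hc : ContDiffAt ℝ 2 c t) :
    DifferentiableAt ℝ (deriv c) t := by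
  have h := (hc.fderiv_right (m := 1) (by norm_num)).clm_apply (contDiffAt_const (c := (1 : ℝ)))
  simp only [fderiv_apply_one_eq_deriv] at h
  exact h.differentiableAt (by norm_num)

/-- The second-order chain rule for a function along a curve. -/
theorem deriv_deriv_comp {r : E → ℝ} {c : ℝ → E} {t : ℝ} (hr : ContDiffAt ℝ 2 r (c t))
    (hc : ContDiffAt ℝ 2 c t) :
    deriv (deriv fun s => r (c s)) t = fderiv ℝ (fderiv ℝ r) (c t) (deriv c t) (deriv c t) +
      fderiv ℝ r (c t) (deriv (deriv c) t) := by
  have h1 : deriv (fun s => r (c s)) =ᶠ[𝓝 t] fun s => fderiv ℝ r (c s) (deriv c s) := by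
    have hc' : ∀ᶠ s in 𝓝 t, ContDiffAt ℝ 2 c s := hc.eventually (by simp)
    have hr' : ∀ᶠ s in 𝓝 t, ContDiffAt ℝ 2 r (c s) :=
      hc.continuousAt.eventually (hr.eventually (by simp))
    filter_upwards [hc', hr'] with s hs hs'
    exact fderiv_comp_deriv s (hs'.differentiableAt (by norm_num))
      (hs.differentiableAt (by norm_num))
  rw [h1.deriv_eq]
  have h2 : HasDerivAt (fun s => fderiv ℝ r (c s))
      (fderiv ℝ (fderiv ℝ r) (c t) (deriv c t)) t :=
    (differentiableAt_fderiv hr).hasFDerivAt.comp_hasDerivAt t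
      (hc.differentiableAt (by norm_num)).hasDerivAt
  exact (h2.clm_apply (differentiableAt_deriv hc).hasDerivAt).deriv

/-- Every vector in the kernel of `dr` is the velocity of a curve in the zero set of `r` whose
deviation from a straight line has a prescribed transversal direction `N`. -/
theorem exists_curve_in_zero_set [CompleteSpace E] {r : E → ℝ} {z v N : E} (hr : ContDiffAt ℝ 2 r z)
    (hz : r z = 0) (hv : fderiv ℝ r z v = 0) (hN : fderiv ℝ r z N ≠ 0) :
    ∃ s : ℝ → ℝ, ContDiffAt ℝ 2 s 0 ∧ s 0 = 0 ∧ deriv s 0 = 0 ∧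
      ∀ᶠ t in 𝓝 (0 : ℝ), r (z + t • v + s t • N) = 0 := by
  set F : ℝ × ℝ → ℝ := fun x => r (z + x.1 • v + x.2 • N) with hF
  have hin : ContDiff ℝ 2 fun x : ℝ × ℝ => z + x.1 • v + x.2 • N := by fun_prop
  have h0 : z + (0 : ℝ × ℝ).1 • v + (0 : ℝ × ℝ).2 • N = z := by simp
  have hFc : ContDiffAt ℝ 2 F 0 := by
    refine ContDiffAt.comp (0 : ℝ × ℝ) ?_ hin.contDiffAt
    rwa [h0]
  have hd : ∀ a b : ℝ, fderiv ℝ F 0 (a, b) = b * fderiv ℝ r z N := by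
    intro a b
    have h1 : HasFDerivAt (fun x : ℝ × ℝ => z + x.1 • v + x.2 • N)
        ((ContinuousLinearMap.fst ℝ ℝ ℝ).smulRight v +
          (ContinuousLinearMap.snd ℝ ℝ ℝ).smulRight N) 0 :=
      ((hasFDerivAt_fst.smul_const v).const_add z).add (hasFDerivAt_snd.smul_const N)
    have h2 : HasFDerivAt r (fderiv ℝ r z) (z + (0 : ℝ × ℝ).1 • v + (0 : ℝ × ℝ).2 • N) := by
      rw [h0]
      exact (hr.differentiableAt (by norm_num)).hasFDerivAt
    have h3 : HasFDerivAt F _ 0 := h2.comp (0 : ℝ × ℝ) h1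
    rw [h3.fderiv]
    simp [hv]
  have hinv : (fderiv ℝ F 0 ∘L .inr ℝ ℝ ℝ).IsInvertible := by
    refine ⟨ContinuousLinearEquiv.unitsEquivAut ℝ (Units.mk0 _ hN), ?_⟩
    ext
    simp [hd]
  refine ⟨hFc.implicitFunction (by norm_num) hinv, ?_, ?_, ?_, ?_⟩
  · exact hFc.contDiffAt_implicitFunction (by norm_num) hinv
  · exact hFc.implicitFunction_apply_self (by norm_num) hinv
  · have h := (hFc.hasStrictFDerivAt_implicitFunction (by norm_num) hinv).hasFDerivAt
    have h' : deriv (hFc.implicitFunction (by norm_num) hinv) (0 : ℝ × ℝ).1 = 0 := by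
      rw [← fderiv_apply_one_eq_deriv, h.fderiv]
      simp [hd]
    exact h'
  · have h := hFc.eventually_apply_implicitFunction (by norm_num) hinv
    have hF0 : F 0 = 0 := by simp [hF, hz]
    rw [hF0] at h
    exact h

/-- If `f` vanishes on the zero set of `r`, then `df = c • dr` at `z`, and the Hessians are related
by the same factor `c` on the kernel of `dr`: both functions vanish along every curve in the zero
set, so the second derivatives along it vanish too. -/
theorem derivs_of_vanishing [CompleteSpace E] {r f : E → ℝ} {z : E} (hr : ContDiffAt ℝ 2 r z)
    (hz : r z = 0) (hdr : fderiv ℝ r z ≠ 0) (hf : ContDiffAt ℝ 2 f z)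
    (hrf : ∀ᶠ y in 𝓝 z, r y = 0 → f y = 0) :
    ∃ c : ℝ, fderiv ℝ f z = c • fderiv ℝ r z ∧ ∀ v, fderiv ℝ r z v = 0 →
      fderiv ℝ (fderiv ℝ f) z v v = c * fderiv ℝ (fderiv ℝ r) z v v := by
  obtain ⟨N, hN⟩ : ∃ N, fderiv ℝ r z N ≠ 0 := by
    by_contra! h
    exact hdr (ContinuousLinearMap.ext h)
  have key : ∀ v, fderiv ℝ r z v = 0 → ∃ a : ℝ, fderiv ℝ f z v = 0 ∧
      fderiv ℝ (fderiv ℝ f) z v v + a * fderiv ℝ f z N = 0 ∧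
      fderiv ℝ (fderiv ℝ r) z v v + a * fderiv ℝ r z N = 0 := by
    intro v hv
    obtain ⟨s, hs, hs0, hds, hrs⟩ := exists_curve_in_zero_set hr hz hv hN
    set c : ℝ → E := fun t => z + t • v + s t • N with hc
    have hcc : ContDiffAt ℝ 2 c 0 := by fun_prop
    have hc0 : c 0 = z := by simp [hc, hs0]
    have hdc' : ∀ᶠ t in 𝓝 0, deriv c t = v + deriv s t • N := by
      filter_upwards [hs.eventually (by simp)] with t ht
      have h1 := (ht.differentiableAt (by norm_num)).hasDerivAt.smul_const N
      have h2 := (((hasDerivAt_id t).smul_const v).const_add z).add h1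
      rw [one_smul] at h2
      exact h2.deriv
    have hdc : deriv c 0 = v := by simp [hdc'.self_of_nhds, hds]
    have hddc : deriv (deriv c) 0 = deriv (deriv s) 0 • N := by
      rw [EventuallyEq.deriv_eq hdc']
      exact (((differentiableAt_deriv hs).hasDerivAt.smul_const N).const_add v).deriv
    have hfs : ∀ᶠ t in 𝓝 0, f (c t) = 0 := by
      have : ∀ᶠ t in 𝓝 0, r (c t) = 0 → f (c t) = 0 := by
        have h := hcc.continuousAt
        rw [ContinuousAt, hc0] at h
        exact h.eventually hrf
      filter_upwards [this, hrs] with t h1 h2 using h1 h2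
    have second : ∀ g : E → ℝ, ContDiffAt ℝ 2 g z → (∀ᶠ t in 𝓝 0, g (c t) = 0) →
        fderiv ℝ (fderiv ℝ g) z v v + deriv (deriv s) 0 * fderiv ℝ g z N = 0 := by
      intro g hg hgc
      have h := deriv_deriv_comp (t := 0) (by rwa [hc0]) hcc (r := g)
      have h' : (fun t => g (c t)) =ᶠ[𝓝 0] fun _ => (0 : ℝ) := hgc
      rw [h'.deriv.deriv_eq, hc0, hdc, hddc] at h
      simpa using h.symm
    refine ⟨deriv (deriv s) 0, ?_, second f hf hfs, second r hr hrs⟩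
    have h := fderiv_comp_deriv (0 : ℝ) (l := f) (f := c)
      (by rw [hc0]; exact hf.differentiableAt (by norm_num)) (hcc.differentiableAt (by norm_num))
    have h' : (f ∘ c) =ᶠ[𝓝 0] fun _ => (0 : ℝ) := hfs
    rw [h'.deriv_eq, hc0, hdc] at h
    simpa using h.symm
  set c := fderiv ℝ f z N / fderiv ℝ r z N with hc
  have hcN : fderiv ℝ f z N = c * fderiv ℝ r z N := by rw [hc]; field_simp
  refine ⟨c, ?_, ?_⟩
  · ext v
    have h1 : fderiv ℝ r z (v - (fderiv ℝ r z v / fderiv ℝ r z N) • N) = 0 := by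
      rw [map_sub, map_smul, smul_eq_mul]; field_simp; ring
    obtain ⟨_, h2, -⟩ := key _ h1
    rw [map_sub, map_smul, smul_eq_mul, hcN, sub_eq_zero] at h2
    rw [h2, _root_.smul_apply, smul_eq_mul]; field_simp
  · intro v hv
    obtain ⟨a, -, h2, h3⟩ := key v hv
    rw [hcN] at h2
    linear_combination h2 - c * h3

end Calculus

/-! ### The differential of the functions `wⱼ` and the Hessian -/

section Complexification

variable {n : ℕ}

/-- The complex-linear form `u ↦ (l u - i l (i u)) / 2` belonging to a real-linear form `l`, in
coordinates. -/
theorem sum_complexify (l : Cn n →L[ℝ] ℝ) (u : Cn n) :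
    ∑ j, u j * (((l (Pi.single j 1) : ℂ) - Complex.I * (l (Pi.single j Complex.I) : ℂ)) / 2) =
      ((l u : ℂ) - Complex.I * (l (Complex.I • u) : ℂ)) / 2 := by
  have key : ∀ u : Cn n, l u = ∑ j, ((u j).re * l (Pi.single j 1) +
      (u j).im * l (Pi.single j Complex.I)) := by
    intro u
    have hu : u = ∑ j, ((u j).re • (Pi.single j 1 : Cn n) +
        (u j).im • (Pi.single j Complex.I : Cn n)) := by
      funext k
      simp only [Finset.sum_apply, Pi.add_apply, Pi.smul_apply, Pi.single_apply, smul_ite,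
        smul_zero,
        Finset.sum_add_distrib, Finset.sum_ite_eq, Finset.mem_univ, if_true, Complex.real_smul,
        mul_one, Complex.re_add_im]
    conv_lhs => rw [hu]
    simp
  rw [key u, key (Complex.I • u)]
  push_cast
  rw [Finset.mul_sum, ← Finset.sum_sub_distrib, Finset.sum_div]
  refine Finset.sum_congr rfl fun j _ => ?_
  conv_lhs => rw [← Complex.re_add_im (u j)]
  simp only [Pi.smul_apply, smul_eq_mul, Complex.mul_re, Complex.mul_im, Complex.I_re, Complex.I_im]
  push_cast
  linear_combination (-(1 / 2 : ℂ) * (u j).im * (l (Pi.single j Complex.I))) * Complex.I_sq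

theorem sum_wirtinger (r : Cn n → ℝ) (z u : Cn n) :
    ∑ j, u j * wirtinger r j z =
      ((fderiv ℝ r z u : ℂ) - Complex.I * (fderiv ℝ r z (Complex.I • u) : ℂ)) / 2 :=
  sum_complexify (fderiv ℝ r z) u

theorem sum_wirtinger_eq_zero {r : Cn n → ℝ} {z u : Cn n} (h1 : fderiv ℝ r z u = 0)
    (h2 : fderiv ℝ r z (Complex.I • u) = 0) : ∑ j, u j * wirtinger r j z = 0 := by
  rw [sum_wirtinger, h1, h2]
  simp

theorem eq_zero_of_sum_wirtinger {r : Cn n → ℝ} {z u : Cn n}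
    (h : ∑ j, u j * wirtinger r j z = 0) :
    fderiv ℝ r z u = 0 ∧ fderiv ℝ r z (Complex.I • u) = 0 := by
  rw [sum_wirtinger] at h
  have h1 := congrArg Complex.re h
  have h2 := congrArg Complex.im h
  simp at h1 h2
  exact ⟨h1, h2⟩

/-- The differential of `∂r/∂zⱼ` is obtained from the Hessian in the same way as `∂r/∂zⱼ` from
the differential. -/
theorem hasFDerivAt_wirtinger {r : Cn n → ℝ} {z : Cn n} (hr : ContDiffAt ℝ 2 r z) (j : Fin n) :
    ∃ L : Cn n →L[ℝ] ℂ, HasFDerivAt (wirtinger r j) L z ∧ ∀ v, L v =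
      ((fderiv ℝ (fderiv ℝ r) z v (Pi.single j 1) : ℂ) -
        Complex.I * (fderiv ℝ (fderiv ℝ r) z v (Pi.single j Complex.I) : ℂ)) / 2 := by
  have h := (differentiableAt_fderiv hr).hasFDerivAt
  have h1 : ∀ e : Cn n, HasFDerivAt (fun y => ((fderiv ℝ r y e : ℝ) : ℂ))
      (Complex.ofRealCLM ∘L (ContinuousLinearMap.apply ℝ ℝ e ∘L fderiv ℝ (fderiv ℝ r) z)) z :=
    fun e => Complex.ofRealCLM.hasFDerivAt.comp z
      ((ContinuousLinearMap.apply ℝ ℝ e).hasFDerivAt.comp z h)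
  have h2 := ((h1 (Pi.single j 1)).sub ((h1 (Pi.single j Complex.I)).const_mul Complex.I)).mul_const
    (2⁻¹ : ℂ)
  refine ⟨_, h2, fun v => ?_⟩
  simp [div_eq_inv_mul]

theorem sum_fderiv_wirtinger {r : Cn n → ℝ} {z : Cn n} (hr : ContDiffAt ℝ 2 r z) (u v : Cn n) :
    ∑ j, u j * fderiv ℝ (wirtinger r j) z v = ((fderiv ℝ (fderiv ℝ r) z v u : ℂ) -
        Complex.I * (fderiv ℝ (fderiv ℝ r) z v (Complex.I • u) : ℂ)) / 2 := by
  rw [← sum_complexify]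
  refine Finset.sum_congr rfl fun j _ => ?_
  obtain ⟨L, hL, hLv⟩ := hasFDerivAt_wirtinger hr j
  rw [hL.fderiv, hLv]

theorem differentiableAt_wirtinger {r : Cn n → ℝ} {z : Cn n} (hr : ContDiffAt ℝ 2 r z)
    (j : Fin n) : DifferentiableAt ℝ (wirtinger r j) z :=
  (hasFDerivAt_wirtinger hr j).choose_spec.1.differentiableAt

theorem differentiableAt_denom {r : Cn n → ℝ} {z : Cn n} (hr : ContDiffAt ℝ 2 r z) :
    DifferentiableAt ℝ (denom r) z := by
  have := differentiableAt_wirtinger hr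
  unfold denom
  fun_prop

theorem fderiv_denom {r : Cn n → ℝ} {z : Cn n} (hr : ContDiffAt ℝ 2 r z) (v : Cn n) :
    fderiv ℝ (denom r) z v = ∑ k, v k * wirtinger r k z +
      ∑ k, z k * fderiv ℝ (wirtinger r k) z v := by
  have h : HasFDerivAt (denom r) (∑ k, (z k • fderiv ℝ (wirtinger r k) z +
      wirtinger r k z • (ContinuousLinearMap.proj k : Cn n →L[ℝ] ℂ))) z :=
    HasFDerivAt.fun_sum fun k _ => (hasFDerivAt_apply k z).mul
      (differentiableAt_wirtinger hr k).hasFDerivAt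
  rw [h.fderiv, ← Finset.sum_add_distrib]
  simp only [_root_.sum_apply]
  refine Finset.sum_congr rfl fun k _ => ?_
  simp
  ring

theorem differentiableAt_dualCoord {r : Cn n → ℝ} {z : Cn n} (hr : ContDiffAt ℝ 2 r z)
    (hD : denom r z ≠ 0) (j : Fin n) : DifferentiableAt ℝ (dualCoord r j) z := by
  have h1 := differentiableAt_wirtinger hr j
  have h2 := differentiableAt_denom hr
  unfold dualCoord
  simp only [div_eq_mul_inv]
  exact h1.mul (h2.inv hD)

theorem fderiv_dualCoord {r : Cn n → ℝ} {z : Cn n} (hr : ContDiffAt ℝ 2 r z)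
    (hD : denom r z ≠ 0) (j : Fin n) (v : Cn n) :
    fderiv ℝ (dualCoord r j) z v = fderiv ℝ (wirtinger r j) z v / denom r z -
      wirtinger r j z * fderiv ℝ (denom r) z v / denom r z ^ 2 := by
  have h1 := (differentiableAt_wirtinger hr j).hasFDerivAt
  have h2 := (differentiableAt_dualCoord hr hD j).hasFDerivAt.mul
    (differentiableAt_denom hr).hasFDerivAt
  have h3 : ∀ᶠ y in 𝓝 z, wirtinger r j y = dualCoord r j y * denom r y := by
    filter_upwards [(differentiableAt_denom hr).continuousAt.eventually_ne hD] with y hy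
    rw [dualCoord, div_mul_cancel₀ _ hy]
  have h4 := congrArg (fun L : Cn n →L[ℝ] ℂ => L v) (h1.unique (h2.congr_of_eventuallyEq h3))
  simp [dualCoord] at h4
  rw [h4]
  field_simp
  ring

/-- For `x`, `y` in the complex tangent space, the condition `dwⱼ(x) = i dwⱼ(y)` for all `j` says
that `Hess r (x, u) = Hess r (y, i u)` for all `u` in the complex tangent space. Up to the factor
`denom r z`, the pairing of `u` with the vector `(dwⱼ(v))ⱼ` is
`(Hess r (v, u) - i Hess r (v, i u)) / 2`, while `∑ zⱼ dwⱼ(v) = 0` because `∑ zⱼ wⱼ = 1`. -/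
theorem fderiv_dualCoord_eq_I_mul_iff {r : Cn n → ℝ} {z : Cn n} (hr : ContDiffAt ℝ 2 r z)
    (hD : denom r z ≠ 0) {x y : Cn n} (hx : ∑ j, x j * wirtinger r j z = 0)
    (hy : ∑ j, y j * wirtinger r j z = 0) :
    (∀ j, fderiv ℝ (dualCoord r j) z x = Complex.I * fderiv ℝ (dualCoord r j) z y) ↔
      ∀ u : Cn n, ∑ j, u j * wirtinger r j z = 0 →
        fderiv ℝ (fderiv ℝ r) z x u = fderiv ℝ (fderiv ℝ r) z y (Complex.I • u) := by
  have sum_tangent : ∀ u v : Cn n, ∑ j, u j * wirtinger r j z = 0 →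
      (∑ j, u j * fderiv ℝ (dualCoord r j) z v) * denom r z =
        ((fderiv ℝ (fderiv ℝ r) z v u : ℂ) -
          Complex.I * (fderiv ℝ (fderiv ℝ r) z v (Complex.I • u) : ℂ)) / 2 := by
    intro u v hu
    rw [← sum_fderiv_wirtinger hr, Finset.sum_mul]
    have : ∀ j, u j * fderiv ℝ (dualCoord r j) z v * denom r z =
        u j * fderiv ℝ (wirtinger r j) z v -
          u j * wirtinger r j z * (fderiv ℝ (denom r) z v / denom r z) := by
      intro j
      rw [fderiv_dualCoord hr hD]
      field_simp
    simp only [this, Finset.sum_sub_distrib, ← Finset.sum_mul, hu, zero_mul, sub_zero]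
  have sum_position : ∀ v : Cn n, ∑ j, v j * wirtinger r j z = 0 →
      ∑ j, z j * fderiv ℝ (dualCoord r j) z v = 0 := by
    intro v hv
    have hd := fderiv_denom hr v
    rw [hv, zero_add] at hd
    have : ∀ j, z j * fderiv ℝ (dualCoord r j) z v =
        z j * fderiv ℝ (wirtinger r j) z v / denom r z -
          z j * wirtinger r j z * (fderiv ℝ (denom r) z v / denom r z ^ 2) := by
      intro j
      rw [fderiv_dualCoord hr hD]
      ring
    simp only [this, Finset.sum_sub_distrib, ← Finset.sum_mul, ← Finset.sum_div, ← hd]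
    rw [← denom]
    field_simp
    ring
  constructor
  · intro h u hu
    have h1 := sum_tangent u x hu
    have h2 := sum_tangent u y hu
    have h3 : ∑ j, u j * fderiv ℝ (dualCoord r j) z x =
        Complex.I * ∑ j, u j * fderiv ℝ (dualCoord r j) z y := by
      rw [Finset.mul_sum]
      refine Finset.sum_congr rfl fun j _ => ?_
      rw [h]
      ring
    rw [h3, mul_assoc, h2] at h1
    have h4 := congrArg Complex.re h1
    simp at h4
    linarith
  · intro h
    set ξ : Fin n → ℂ := fun j =>
      fderiv ℝ (dualCoord r j) z x - Complex.I * fderiv ℝ (dualCoord r j) z y with hξ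
    have hsum : ∀ u : Cn n, ∑ j, u j * ξ j = ∑ j, u j * fderiv ℝ (dualCoord r j) z x -
        Complex.I * ∑ j, u j * fderiv ℝ (dualCoord r j) z y := by
      intro u
      rw [Finset.mul_sum, ← Finset.sum_sub_distrib]
      exact Finset.sum_congr rfl fun j _ => by rw [hξ]; ring
    have h1 : ∀ u : Cn n, ∑ j, u j * wirtinger r j z = 0 → ∑ j, u j * ξ j = 0 := by
      intro u hu
      have hIu : ∑ j, (Complex.I • u) j * wirtinger r j z = 0 := by
        simp only [Pi.smul_apply, smul_eq_mul, mul_assoc, ← Finset.mul_sum, hu, mul_zero]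
      have e1 := sum_tangent u x hu
      have e2 := sum_tangent u y hu
      have e3 := h u hu
      have e4 := h _ hIu
      rw [smul_smul, Complex.I_mul_I, neg_one_smul, map_neg] at e4
      rw [e3, e4] at e1
      have : (∑ j, u j * ξ j) * denom r z = 0 := by
        rw [hsum, sub_mul, mul_assoc, e1, e2]
        push_cast
        linear_combination (1 / 2 : ℂ) *
          (fderiv ℝ (fderiv ℝ r) z y (Complex.I • u) : ℂ) * Complex.I_sq
      exact (mul_eq_zero.1 this).resolve_right hD
    have h2 : ∑ j, z j * ξ j = 0 := by
      rw [hsum, sum_position x hx, sum_position y hy]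
      simp
    intro j
    -- The kernel of `∂r` and the position vector `z` span `ℂⁿ`.
    set c : ℂ := (∑ k, (Pi.single j 1 : Cn n) k * wirtinger r k z) / denom r z with hc
    have h3 := h1 (Pi.single j 1 - c • z) (by
      simp only [Pi.sub_apply, Pi.smul_apply, smul_eq_mul, sub_mul, Finset.sum_sub_distrib,
        mul_assoc, ← Finset.mul_sum]
      rw [← denom, hc, div_mul_cancel₀ _ hD, sub_self])
    simp only [Pi.sub_apply, Pi.smul_apply, smul_eq_mul, sub_mul, Finset.sum_sub_distrib,
      mul_assoc, ← Finset.mul_sum, h2, mul_zero, sub_zero] at h3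
    simpa [Pi.single_apply, hξ, sub_eq_zero] using h3

end Complexification

/-! ### Affine coordinates and projective invariance of the Hessian -/

section Charts

variable {n : ℕ}

theorem affineChart_mem_atlas (g : Cn1 n ≃ₗ[ℂ] Cn1 n) : affineChart g ∈ atlas (Cn n) (CP n) :=
  mem_range_self g

theorem contMDiffOn_affineCoord (g : Cn1 n ≃ₗ[ℂ] Cn1 n) :
    ContMDiffOn 𝓘(ℝ, Cn n) 𝓘(ℝ, Cn n) ∞ (affineCoord g) (affineDomain g) :=
  contMDiffOn_of_mem_maximalAtlas (IsManifold.subset_maximalAtlas (affineChart_mem_atlas g))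

theorem contMDiff_affinePoint (g : Cn1 n ≃ₗ[ℂ] Cn1 n) :
    ContMDiff 𝓘(ℝ, Cn n) 𝓘(ℝ, Cn n) ∞ (affinePoint g) :=
  contMDiffOn_univ.1 (contMDiffOn_symm_of_mem_maximalAtlas
    (IsManifold.subset_maximalAtlas (affineChart_mem_atlas g)))

theorem mdifferentiable_affineChart (g : Cn1 n ≃ₗ[ℂ] Cn1 n) :
    (affineChart g).MDifferentiable 𝓘(ℝ, Cn n) 𝓘(ℝ, Cn n) :=
  haveI : IsManifold 𝓘(ℝ, Cn n) 1 (CP n) := IsManifold.of_le (n := ∞) (by simp)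
  mdifferentiable_of_mem_atlas (affineChart_mem_atlas g)

theorem eventually_affinePoint_mem (g : Cn1 n ≃ₗ[ℂ] Cn1 n) {q : CP n} (hq : q ∈ affineDomain g)
    {p : CP n → Prop} (h : ∀ᶠ x in 𝓝 q, p x) :
    ∀ᶠ z in 𝓝 (affineCoord g q), p (affinePoint g z) := by
  have hc := (continuous_affinePoint g).continuousAt (x := affineCoord g q)
  rw [ContinuousAt, affinePoint_affineCoord g q hq] at hc
  exact hc.eventually h

theorem coordDifferential_bijective (g : Cn1 n ≃ₗ[ℂ] Cn1 n) {q : CP n} (hq : q ∈ affineDomain g) :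
    Function.Bijective (coordDifferential g q) :=
  (mdifferentiable_affineChart g).mfderiv_bijective hq

/-- The differential of `f` on `ℂℙⁿ`, computed in arbitrary affine coordinates. -/
theorem mfderiv_eq_fderiv_comp {F : Type*} [NormedAddCommGroup F] [NormedSpace ℝ F]
    (g : Cn1 n ≃ₗ[ℂ] Cn1 n) {q : CP n} (hq : q ∈ affineDomain g) {f : CP n → F}
    (hf : DifferentiableAt ℝ (f ∘ affinePoint g) (affineCoord g q)) (v : TCP q) :
    mfderiv 𝓘(ℝ, Cn n) 𝓘(ℝ, F) f q v =
      fderiv ℝ (f ∘ affinePoint g) (affineCoord g q) (coordDifferential g q v) := by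
  have h1 : f =ᶠ[𝓝 q] (f ∘ affinePoint g) ∘ affineCoord g := by
    filter_upwards [(isOpen_affineDomain g).mem_nhds hq] with x hx
    simp [affinePoint_affineCoord g x hx]
  have h2 := (hf.hasFDerivAt.hasMFDerivAt).comp q
    ((mdifferentiable_affineChart g).mdifferentiableAt hq).hasMFDerivAt
  rw [(h2.congr_of_eventuallyEq h1).mfderiv]
  rfl

theorem contDiffOn_comp_affinePoint {F : Type*} [NormedAddCommGroup F] [NormedSpace ℝ F]
    (g : Cn1 n ≃ₗ[ℂ] Cn1 n) {f : CP n → F} {U : Set (CP n)}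
    (hf : ContMDiffOn 𝓘(ℝ, Cn n) 𝓘(ℝ, F) ∞ f U) :
    ContDiffOn ℝ ∞ (f ∘ affinePoint g) (affinePoint g ⁻¹' U) :=
  contMDiffOn_iff_contDiffOn.1
    (hf.comp (contMDiff_affinePoint g).contMDiffOn (subset_refl _))

theorem affineCoord_affinePoint_apply (g g' : Cn1 n ≃ₗ[ℂ] Cn1 n) (z : Cn n) :
    affineCoord g' (affinePoint g z) = fun j =>
      g' (g.symm (Fin.cons 1 z : Cn1 n)) j.succ / g' (g.symm (Fin.cons 1 z : Cn1 n)) 0 :=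
  affineCoord_mk g' _ _

/-- The differentials of affine coordinates are complex-linear, since the transition to the
coordinates that identify the tangent space with `ℂⁿ` is holomorphic. -/
theorem coordDifferential_J (g : Cn1 n ≃ₗ[ℂ] Cn1 n) {q : CP n} (hq : q ∈ affineDomain g)
    (v : TCP q) : coordDifferential g q (J q v) = Complex.I • coordDifferential g q v := by
  obtain ⟨g', hg', hgg'⟩ : ∃ g' : Cn1 n ≃ₗ[ℂ] Cn1 n, q ∈ affineDomain g' ∧
      chartAt (Cn n) q = affineChart g' :=
    ⟨_, (exists_mem_affineDomain q).choose_spec, rfl⟩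
  have hL : ∀ v : TCP q, coordDifferential g q v =
      fderiv ℝ (affineCoord g ∘ affinePoint g') (affineCoord g' q) v := by
    intro v
    have h := ((mdifferentiable_affineChart g).mdifferentiableAt hq).mfderiv
    change mfderiv 𝓘(ℝ, Cn n) 𝓘(ℝ, Cn n) (affineChart g) q v = _
    rw [h]
    simp [writtenInExtChartAt, extChartAt, hgg']
    rfl
  have hT : DifferentiableAt ℂ (affineCoord g ∘ affinePoint g') (affineCoord g' q) := by
    have h := (contDiffOn_transition (𝕜 := ℂ) 1 g' g).contDiffAt
      (x := affineCoord g' q) (((isOpen_affineDomain g).preimage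
        (continuous_affinePoint g')).mem_nhds
          (by simpa [affinePoint_affineCoord g' q hg'] using hq))
    exact h.differentiableAt (by norm_num)
  rw [hL, hL, (hT.hasFDerivAt.restrictScalars ℝ).fderiv]
  exact (fderiv ℂ (affineCoord g ∘ affinePoint g') (affineCoord g' q)).map_smul Complex.I v

/-- A change of affine coordinates maps the real line through `q` in direction `v` into the complex
line in the direction of the image of `v`, with parameter `φ t = t a₀ / (a₀ + t b₀)`. -/
theorem exists_reparametrization (g g' : Cn1 n ≃ₗ[ℂ] Cn1 n) {q : CP n} (hq : q ∈ affineDomain g)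
    (hq' : q ∈ affineDomain g') (v : TCP q) :
    ∃ φ : ℝ → ℂ, ContDiffAt ℝ 2 φ 0 ∧ φ 0 = 0 ∧ deriv φ 0 = 1 ∧ ∀ᶠ t : ℝ in 𝓝 0,
      affineCoord g' (affinePoint g (affineCoord g q + t • coordDifferential g q v)) =
        affineCoord g' q + φ t • coordDifferential g' q v := by
  set z := affineCoord g q with hz
  set u := coordDifferential g q v with hu
  set a : Cn1 n := g' (g.symm (Fin.cons 1 z)) with ha
  set b : Cn1 n := g' (g.symm (Fin.cons 0 u)) with hb
  have hline : ∀ t : ℝ, g' (g.symm (Fin.cons 1 (z + t • u))) = a + (t : ℂ) • b := by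
    intro t
    have h : (Fin.cons 1 (z + t • u) : Cn1 n) = Fin.cons 1 z + (t : ℂ) • Fin.cons 0 u := by
      funext i
      refine Fin.cases ?_ (fun j => ?_) i <;> simp
    rw [h, map_add, map_smul, map_add, map_smul]
  have ha0 : a 0 ≠ 0 := by
    have : affinePoint g z ∈ affineDomain g' := by rwa [hz, affinePoint_affineCoord g q hq]
    exact (mk_mem_affineDomain g' _ _).1 this
  set φ : ℝ → ℂ := fun t => t * a 0 / (a 0 + t * b 0) with hφ
  set w : Cn n := fun j => (b j.succ * a 0 - a j.succ * b 0) / a 0 ^ 2 with hw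
  have hof : ContDiff ℝ 2 fun t : ℝ => (t : ℂ) := Complex.ofRealCLM.contDiff
  have hden : ContDiff ℝ 2 fun t : ℝ => a 0 + (t : ℂ) * b 0 :=
    contDiff_const.add (hof.mul contDiff_const)
  have hne : ∀ᶠ t : ℝ in 𝓝 0, a 0 + (t : ℂ) * b 0 ≠ 0 :=
    hden.continuous.continuousAt.eventually_ne (by simpa using ha0)
  have hφc : ContDiffAt ℝ 2 φ 0 := by
    simp only [hφ, div_eq_mul_inv]
    exact (hof.mul contDiff_const).contDiffAt.mul
      (hden.contDiffAt.inv (by simpa using ha0))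
  have hφd : HasDerivAt φ 1 0 := by
    have h1 : HasDerivAt (fun t : ℝ => (t : ℂ)) 1 0 := Complex.ofRealCLM.hasDerivAt
    have h2 := (h1.mul_const (a 0)).div ((h1.mul_const (b 0)).const_add (a 0))
      (by simpa using ha0)
    convert! h2 using 1
    simp
    field_simp
  have hq0 : affineCoord g' q = fun j => a j.succ / a 0 := by
    conv_lhs => rw [← affinePoint_affineCoord g q hq, affineCoord_affinePoint_apply]
  have hT : ∀ᶠ t : ℝ in 𝓝 0, affineCoord g' (affinePoint g (z + t • u)) =
      affineCoord g' q + φ t • w := by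
    filter_upwards [hne] with t ht
    rw [affineCoord_affinePoint_apply, hline, hq0]
    funext j
    simp only [Pi.add_apply, Pi.smul_apply, smul_eq_mul, hφ, hw]
    field_simp
    ring
  have hw' : coordDifferential g' q v = w := by
    have hd : DifferentiableAt ℝ (affineCoord g' ∘ affinePoint g) z := by
      have h := (contDiffOn_transition (𝕜 := ℝ) 1 g g').contDiffAt
        (x := z) (((isOpen_affineDomain g').preimage
          (continuous_affinePoint g)).mem_nhds (by
            rw [mem_preimage, hz, affinePoint_affineCoord g q hq]; exact hq'))
      exact h.differentiableAt (by norm_num)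
    have h1 : coordDifferential g' q v = fderiv ℝ (affineCoord g' ∘ affinePoint g) z u :=
      mfderiv_eq_fderiv_comp g hq hd v
    have h2 : HasDerivAt (fun t : ℝ => z + t • u) u 0 := by
      simpa using ((hasDerivAt_id (0 : ℝ)).smul_const u).const_add z
    have h3 : HasDerivAt (fun t : ℝ => affineCoord g' (affinePoint g (z + t • u)))
        (fderiv ℝ (affineCoord g' ∘ affinePoint g) z u) 0 := by
      refine HasFDerivAt.comp_hasDerivAt (l := affineCoord g' ∘ affinePoint g) 0 ?_ h2
      simpa using hd.hasFDerivAt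
    have h4 : HasDerivAt (fun t : ℝ => affineCoord g' q + φ t • w) w 0 := by
      simpa using (hφd.smul_const w).const_add (affineCoord g' q)
    rw [h1]
    exact h3.unique (h4.congr_of_eventuallyEq hT)
  rw [hw']
  exact ⟨φ, hφc, by simp [hφ], hφd.deriv, hT⟩

theorem contDiffAt_comp_affinePoint (g g' : Cn1 n ≃ₗ[ℂ] Cn1 n) {q : CP n}
    (hq : q ∈ affineDomain g) (hq' : q ∈ affineDomain g') {f : CP n → ℝ} {m : WithTop ℕ∞}
    (hf : ContDiffAt ℝ m (f ∘ affinePoint g') (affineCoord g' q)) :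
    ContDiffAt ℝ m (f ∘ affinePoint g) (affineCoord g q) := by
  have hT := (contDiffOn_transition (𝕜 := ℝ) m g g').contDiffAt
    (x := affineCoord g q) (((isOpen_affineDomain g').preimage
      (continuous_affinePoint g)).mem_nhds (by
        rw [mem_preimage, affinePoint_affineCoord g q hq]; exact hq'))
  have h := ContDiffAt.comp (g := f ∘ affinePoint g') (affineCoord g q)
    (by rwa [affinePoint_affineCoord g q hq]) hT
  refine h.congr_of_eventuallyEq ?_
  filter_upwards [eventually_affinePoint_mem g hq ((isOpen_affineDomain g').mem_nhds hq')] with z hz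
  simp [affinePoint_affineCoord g' _ hz]

/-- The Hessian at `q` of `ρ` in the affine coordinates `g`, transported to the tangent space of
`ℂℙⁿ`. It depends on `g`. -/
def chartHessian (g : Cn1 n ≃ₗ[ℂ] Cn1 n) (ρ : CP n → ℝ) (q : CP n) :
    LinearMap.BilinForm ℝ (TCP q) :=
  LinearMap.mk₂ ℝ (fun u v => fderiv ℝ (fderiv ℝ (ρ ∘ affinePoint g)) (affineCoord g q)
    (coordDifferential g q u) (coordDifferential g q v))
    (fun _ _ _ => by simp) (fun _ _ _ => by simp) (fun _ _ _ => by simp) (fun _ _ _ => by simp)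

theorem chartHessian_apply (g : Cn1 n ≃ₗ[ℂ] Cn1 n) (ρ : CP n → ℝ) (q : CP n) (u v : TCP q) :
    chartHessian g ρ q u v = fderiv ℝ (fderiv ℝ (ρ ∘ affinePoint g)) (affineCoord g q)
      (coordDifferential g q u) (coordDifferential g q v) := rfl

/-- On complex tangent vectors, the Hessian does not depend on the affine coordinates. By
`exists_reparametrization` the difference of the two quadratic forms is the value of `dρ` at a
complex multiple of `v`. -/
theorem chartHessian_change (g g' : Cn1 n ≃ₗ[ℂ] Cn1 n) {q : CP n} (hq : q ∈ affineDomain g)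
    (hq' : q ∈ affineDomain g') {ρ : CP n → ℝ}
    (hρ : ContDiffAt ℝ 2 (ρ ∘ affinePoint g') (affineCoord g' q)) {v : TCP q}
    (hv : mfderiv 𝓘(ℝ, Cn n) 𝓘(ℝ, ℝ) ρ q v = 0)
    (hJv : mfderiv 𝓘(ℝ, Cn n) 𝓘(ℝ, ℝ) ρ q (J q v) = 0) :
    chartHessian g ρ q v v = chartHessian g' ρ q v v := by
  obtain ⟨φ, hφ, hφ0, hφd, hφT⟩ := exists_reparametrization g g' hq hq' v
  have hρ' := contDiffAt_comp_affinePoint g g' hq hq' hρ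
  rw [mfderiv_eq_fderiv_comp g' hq' (hρ.differentiableAt (by norm_num))] at hv hJv
  rw [coordDifferential_J g' hq'] at hJv
  rw [chartHessian_apply, chartHessian_apply]
  set z := affineCoord g q
  set z' := affineCoord g' q
  set x := coordDifferential g q v
  set x' := coordDifferential g' q v
  have hdφ := differentiableAt_deriv hφ
  have e1 := deriv_deriv_comp (r := ρ ∘ affinePoint g) (c := fun t : ℝ => z + t • x) (t := 0)
    (by simpa using hρ') (by fun_prop)
  have e2 := deriv_deriv_comp (r := ρ ∘ affinePoint g') (c := fun t : ℝ => z' + φ t • x') (t := 0)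
    (by simpa [hφ0] using hρ) (by fun_prop)
  have hline : deriv (fun t : ℝ => z + t • x) = fun _ => x := by
    funext t
    simpa using (((hasDerivAt_id t).smul_const x).const_add z).deriv
  have hcurve : deriv (fun t : ℝ => z' + φ t • x') =ᶠ[𝓝 0] fun t => deriv φ t • x' := by
    filter_upwards [hφ.eventually (by simp)] with t ht
    exact (((ht.differentiableAt (by norm_num)).hasDerivAt.smul_const x').const_add z').deriv
  rw [hcurve.deriv_eq, hcurve.self_of_nhds, (hdφ.hasDerivAt.smul_const x').deriv] at e2
  beta_reduce at e2
  rw [hφd] at e2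
  have hcomplex : fderiv ℝ (ρ ∘ affinePoint g') z' (deriv (deriv φ) 0 • x') = 0 := by
    have : deriv (deriv φ) 0 • x' = (deriv (deriv φ) 0).re • x' +
        (deriv (deriv φ) 0).im • Complex.I • x' := by
      conv_lhs => rw [← Complex.re_add_im (deriv (deriv φ) 0)]
      rw [add_smul, mul_smul]
      rfl
    have hv' : fderiv ℝ (ρ ∘ affinePoint g') z' x' = 0 := hv
    have hJv' : fderiv ℝ (ρ ∘ affinePoint g') z' (Complex.I • x') = 0 := hJv
    rw [this, map_add, map_smul, map_smul, hv', hJv', smul_zero, smul_zero, add_zero]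
  have heq : (fun t : ℝ => (ρ ∘ affinePoint g) (z + t • x)) =ᶠ[𝓝 0]
      fun t => (ρ ∘ affinePoint g') (z' + φ t • x') := by
    have hc : Continuous fun t : ℝ => z + t • x := by fun_prop
    have hc0 := hc.continuousAt (x := 0)
    rw [ContinuousAt, zero_smul, add_zero] at hc0
    filter_upwards [hφT, hc0.eventually (eventually_affinePoint_mem g hq
      ((isOpen_affineDomain g').mem_nhds hq'))] with t ht1 ht2
    simp only [Function.comp]
    rw [← ht1, affinePoint_affineCoord g' _ ht2]
  rw [heq.deriv.deriv_eq, e2] at e1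
  simp only [hφ0, zero_smul, add_zero, hline, deriv_const, map_zero, one_smul, hcomplex] at e1
  exact e1.symm

end Charts

/-! ### The Hessian of a hypersurface on its maximal complex subspaces -/

section Hypersurfaces

variable {n : ℕ} {S : Set (CP n)} {p : CP n} {ρ ρ' : CP n → ℝ}

theorem IsLocalDefiningFunction.eventually_mem_iff (hρ : IsLocalDefiningFunction S p ρ) :
    ∀ᶠ q in 𝓝 p, q ∈ S ↔ ρ q = 0 := by
  obtain ⟨U, hU, hpU, -, h, -⟩ := hρ
  filter_upwards [hU.mem_nhds hpU] with q hq using h q hq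

theorem IsLocalDefiningFunction.contDiffAt (hρ : IsLocalDefiningFunction S p ρ)
    {g : Cn1 n ≃ₗ[ℂ] Cn1 n} (hg : p ∈ affineDomain g) :
    ContDiffAt ℝ 2 (ρ ∘ affinePoint g) (affineCoord g p) := by
  obtain ⟨U, hU, hpU, h, -, -⟩ := hρ
  refine ((contDiffOn_comp_affinePoint g h).contDiffAt
    ((hU.preimage (continuous_affinePoint g)).mem_nhds ?_)).of_le ENat.LEInfty.out
  rwa [mem_preimage, affinePoint_affineCoord g p hg]

theorem IsLocalDefiningFunction.mfderiv_apply (hρ : IsLocalDefiningFunction S p ρ)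
    {g : Cn1 n ≃ₗ[ℂ] Cn1 n} (hg : p ∈ affineDomain g) (v : TCP p) :
    mfderiv 𝓘(ℝ, Cn n) 𝓘(ℝ, ℝ) ρ p v =
      fderiv ℝ (ρ ∘ affinePoint g) (affineCoord g p) (coordDifferential g p v) :=
  mfderiv_eq_fderiv_comp g hg ((hρ.contDiffAt hg).differentiableAt (by norm_num)) v

theorem IsLocalDefiningFunction.fderiv_ne_zero (hρ : IsLocalDefiningFunction S p ρ)
    {g : Cn1 n ≃ₗ[ℂ] Cn1 n} (hg : p ∈ affineDomain g) :
    fderiv ℝ (ρ ∘ affinePoint g) (affineCoord g p) ≠ 0 := by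
  intro h
  obtain ⟨U, hU, hpU, -, -, h'⟩ := id hρ
  refine h' (ContinuousLinearMap.ext fun v => ?_)
  rw [hρ.mfderiv_apply hg, h]
  rfl

theorem derivs_of_vanishing_on_hypersurface (hp : p ∈ S) (hρ : IsLocalDefiningFunction S p ρ)
    {g : Cn1 n ≃ₗ[ℂ] Cn1 n} (hg : p ∈ affineDomain g) {f : CP n → ℝ}
    (hf : ContDiffAt ℝ 2 (f ∘ affinePoint g) (affineCoord g p))
    (hfS : ∀ᶠ q in 𝓝 p, q ∈ S → f q = 0) :
    ∃ c : ℝ, fderiv ℝ (f ∘ affinePoint g) (affineCoord g p) =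
        c • fderiv ℝ (ρ ∘ affinePoint g) (affineCoord g p) ∧
      ∀ v, mfderiv 𝓘(ℝ, Cn n) 𝓘(ℝ, ℝ) ρ p v = 0 →
        chartHessian g f p v v = c * chartHessian g ρ p v v := by
  obtain ⟨c, h1, h2⟩ := derivs_of_vanishing (hρ.contDiffAt hg)
    (by simpa [affinePoint_affineCoord g p hg] using hρ.eventually_mem_iff.self_of_nhds.1 hp)
    (hρ.fderiv_ne_zero hg) hf (by
      filter_upwards [eventually_affinePoint_mem g hg hρ.eventually_mem_iff,
        eventually_affinePoint_mem g hg hfS] with z h1 h2 h3 using h2 (h1.2 h3))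
  refine ⟨c, h1, fun v hv => h2 _ ?_⟩
  rw [hρ.mfderiv_apply hg] at hv
  exact hv

/-- A smooth function vanishing on `S` has vanishing differential on `T_p S`. -/
theorem fderiv_eq_zero_of_vanishing (hp : p ∈ S) (hρ : IsLocalDefiningFunction S p ρ)
    {g : Cn1 n ≃ₗ[ℂ] Cn1 n} (hg : p ∈ affineDomain g) {f : CP n → ℝ}
    (hf : ContDiffAt ℝ 2 (f ∘ affinePoint g) (affineCoord g p))
    (hfS : ∀ᶠ q in 𝓝 p, q ∈ S → f q = 0) {v : TCP p}
    (hv : mfderiv 𝓘(ℝ, Cn n) 𝓘(ℝ, ℝ) ρ p v = 0) :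
    fderiv ℝ (f ∘ affinePoint g) (affineCoord g p) (coordDifferential g p v) = 0 := by
  obtain ⟨c, h, -⟩ := derivs_of_vanishing_on_hypersurface hp hρ hg hf hfS
  rw [hρ.mfderiv_apply hg] at hv
  have hv' : fderiv ℝ (ρ ∘ affinePoint g) (affineCoord g p) (coordDifferential g p v) = 0 := hv
  rw [h, _root_.smul_apply, hv', smul_zero]

/-- A single local defining function determines `T_p S`. -/
theorem mem_tangentSpaceOf_iff (hp : p ∈ S) (hρ : IsLocalDefiningFunction S p ρ) (v : TCP p) :
    v ∈ tangentSpaceOf S p ↔ mfderiv 𝓘(ℝ, Cn n) 𝓘(ℝ, ℝ) ρ p v = 0 := by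
  refine ⟨fun h => h ρ hρ, fun h ρ' hρ' => ?_⟩
  obtain ⟨g, hg⟩ := exists_mem_affineDomain p
  rw [hρ'.mfderiv_apply hg]
  refine fderiv_eq_zero_of_vanishing hp hρ hg (hρ'.contDiffAt hg) ?_ h
  filter_upwards [hρ'.eventually_mem_iff] with q hq using hq.1

theorem mem_H_iff (hp : p ∈ S) (hρ : IsLocalDefiningFunction S p ρ) (v : TCP p) :
    v ∈ H S p ↔ mfderiv 𝓘(ℝ, Cn n) 𝓘(ℝ, ℝ) ρ p v = 0 ∧
      mfderiv 𝓘(ℝ, Cn n) 𝓘(ℝ, ℝ) ρ p (J p v) = 0 := by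
  rw [← mem_tangentSpaceOf_iff hp hρ, ← mem_tangentSpaceOf_iff hp hρ]
  refine ⟨fun h => ⟨h.1, (J_mem_H h).1⟩, fun h => ⟨h.1, -J p v, neg_mem h.2, ?_⟩⟩
  rw [map_neg, J_J, neg_neg]

theorem mem_H_iff_fderiv (hp : p ∈ S) (hρ : IsLocalDefiningFunction S p ρ)
    {g : Cn1 n ≃ₗ[ℂ] Cn1 n} (hg : p ∈ affineDomain g) (v : TCP p) :
    v ∈ H S p ↔
      fderiv ℝ (ρ ∘ affinePoint g) (affineCoord g p) (coordDifferential g p v) = 0 ∧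
      fderiv ℝ (ρ ∘ affinePoint g) (affineCoord g p)
        (Complex.I • coordDifferential g p v) = 0 := by
  rw [mem_H_iff hp hρ, hρ.mfderiv_apply hg, hρ.mfderiv_apply hg, coordDifferential_J g hg]
  rfl

theorem exists_mem_H_of_fderiv (hp : p ∈ S) (hρ : IsLocalDefiningFunction S p ρ)
    {g : Cn1 n ≃ₗ[ℂ] Cn1 n} (hg : p ∈ affineDomain g) {u : Cn n}
    (h1 : fderiv ℝ (ρ ∘ affinePoint g) (affineCoord g p) u = 0)
    (h2 : fderiv ℝ (ρ ∘ affinePoint g) (affineCoord g p) (Complex.I • u) = 0) :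
    ∃ v ∈ H S p, coordDifferential g p v = u := by
  obtain ⟨v, rfl⟩ := (coordDifferential_bijective g hg).2 u
  exact ⟨v, (mem_H_iff_fderiv hp hρ hg v).2 ⟨h1, h2⟩, rfl⟩

theorem chartHessian_symm (hρ : IsLocalDefiningFunction S p ρ)
    {g : Cn1 n ≃ₗ[ℂ] Cn1 n} (hg : p ∈ affineDomain g) (u v : TCP p) :
    chartHessian g ρ p u v = chartHessian g ρ p v u :=
  hessian_symm (hρ.contDiffAt hg) _ _

/-- The Hessians on `H_p S` of all local defining functions in all affine coordinates are nonzero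
multiples of each other. -/
theorem exists_chartHessian_eq_mul (hp : p ∈ S) (hρ : IsLocalDefiningFunction S p ρ)
    (hρ' : IsLocalDefiningFunction S p ρ') {g g' : Cn1 n ≃ₗ[ℂ] Cn1 n} (hg : p ∈ affineDomain g)
    (hg' : p ∈ affineDomain g') :
    ∃ c : ℝ, c ≠ 0 ∧ ∀ u ∈ H S p, ∀ v ∈ H S p,
      chartHessian g' ρ' p u v = c * chartHessian g ρ p u v := by
  obtain ⟨c, h1, h2⟩ := derivs_of_vanishing_on_hypersurface hp hρ hg (hρ'.contDiffAt hg)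
    (by filter_upwards [hρ'.eventually_mem_iff] with q hq using hq.1)
  have hquad : ∀ v ∈ H S p, chartHessian g' ρ' p v v = c * chartHessian g ρ p v v := by
    intro v hv
    obtain ⟨h3, h4⟩ := (mem_H_iff hp hρ' v).1 hv
    rw [chartHessian_change g' g hg' hg (hρ'.contDiffAt hg) h3 h4]
    exact h2 v ((mem_H_iff hp hρ v).1 hv).1
  refine ⟨c, ?_, fun u hu v hv => ?_⟩
  · rintro rfl
    exact hρ'.fderiv_ne_zero hg (by rw [h1, zero_smul])
  · have h := hquad (u + v) (add_mem hu hv)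
    simp only [map_add, LinearMap.add_apply] at h
    rw [hquad u hu, hquad v hv, chartHessian_symm hρ' hg' v u, chartHessian_symm hρ hg v u] at h
    linarith

/-- Strong convexity in some affine chart gives a Hessian that is positive definite on `H_p S`. -/
theorem exists_chartHessian_pos (hS : IsStronglyCConvex S) (hp : p ∈ S) :
    ∃ (g : Cn1 n ≃ₗ[ℂ] Cn1 n) (ρ : CP n → ℝ), p ∈ affineDomain g ∧
      IsLocalDefiningFunction S p ρ ∧ ∀ v ∈ H S p, v ≠ 0 → 0 < chartHessian g ρ p v v := by
  obtain ⟨g, W, hW, hpW, hWg, hconv⟩ := hS.2 p hp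
  obtain ⟨r, U, hU, hzU, hr, hrM, hdr, hpos⟩ := hconv (affineCoord g p) ⟨p, ⟨hp, hpW⟩, rfl⟩
  have hg := hWg hpW
  have hcomp : (r ∘ affineCoord g) ∘ affinePoint g = r := by
    funext z
    simp [affineCoord_affinePoint]
  have hdiff : DifferentiableAt ℝ r (affineCoord g p) :=
    (hr.contDiffAt (hU.mem_nhds hzU)).differentiableAt (by simp)
  have hmf : ∀ v, mfderiv 𝓘(ℝ, Cn n) 𝓘(ℝ, ℝ) (r ∘ affineCoord g) p v =
      fderiv ℝ r (affineCoord g p) (coordDifferential g p v) := by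
    intro v
    rw [mfderiv_eq_fderiv_comp g hg (by rwa [hcomp]), hcomp]
  have hρ : IsLocalDefiningFunction S p (r ∘ affineCoord g) := by
    refine ⟨W ∩ (affineDomain g ∩ affineCoord g ⁻¹' U), hW.inter
      ((continuousOn_affineCoord g).isOpen_inter_preimage (isOpen_affineDomain g) hU),
      ⟨hpW, hg, hzU⟩, ?_, ?_, ?_⟩
    · refine hr.contMDiffOn.comp ((contMDiffOn_affineCoord g).mono fun q hq => hq.2.1) ?_
      exact fun q hq => hq.2.2
    · rintro q ⟨hqW, hqg, hqU⟩
      rw [Function.comp, ← hrM _ hqU]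
      refine ⟨fun h => ⟨q, ⟨h, hqW⟩, rfl⟩, ?_⟩
      rintro ⟨q', ⟨hq'S, hq'W⟩, h⟩
      rwa [← (affineChart g).injOn (hWg hq'W) hqg h]
    · intro h
      refine hdr (ContinuousLinearMap.ext fun u => ?_)
      obtain ⟨v, rfl⟩ := (coordDifferential_bijective g hg).2 u
      rw [← hmf, h]
      rfl
  refine ⟨g, r ∘ affineCoord g, hg, hρ, fun v hv hv0 => ?_⟩
  have h1 := ((mem_H_iff_fderiv hp hρ hg v).1 hv).1
  rw [chartHessian_apply]
  rw [hcomp] at h1 ⊢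
  exact hpos _ h1 fun h => hv0 ((coordDifferential_bijective g hg).1 (by rw [h, map_zero]))

end Hypersurfaces

/-! ### Adjoints with respect to a positive definite form -/

section LinearAlgebra

variable {V : Type*} [AddCommGroup V] [Module ℝ V] [FiniteDimensional ℝ V]

theorem exists_adjoint {B : LinearMap.BilinForm ℝ V} (hpos : ∀ v, v ≠ 0 → 0 < B v v)
    (A : V →ₗ[ℝ] V) : ∃ K : V →ₗ[ℝ] V, ∀ u v, B (K v) u = B v (A u) := by
  have hinj : Function.Injective B := by
    rw [injective_iff_map_eq_zero]
    intro v hv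
    by_contra h
    simpa [hv] using hpos v h
  let e : V ≃ₗ[ℝ] Module.Dual ℝ V :=
    LinearEquiv.ofInjectiveOfFinrankEq B hinj Subspace.dual_finrank_eq.symm
  refine ⟨e.symm.toLinearMap ∘ₗ B.compl₂ A, fun u v => ?_⟩
  change e (e.symm _) u = _
  rw [LinearEquiv.apply_symm_apply]
  rfl

/-- A complex structure minus its adjoint is invertible: if `A v = K v`, then
`B (A v) (A v) = B (K v) (A v) = - B v v`. -/
theorem bijective_sub_adjoint {B : LinearMap.BilinForm ℝ V} (hpos : ∀ v, v ≠ 0 → 0 < B v v)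
    {A K : V →ₗ[ℝ] V} (hA : ∀ v, A (A v) = -v) (hK : ∀ u v, B (K v) u = B v (A u)) :
    Function.Bijective (A - K) := by
  have hinj : Function.Injective (A - K) := by
    rw [injective_iff_map_eq_zero]
    intro v hv
    by_contra h0
    have hAv : A v = K v := sub_eq_zero.1 hv
    have hAv0 : A v ≠ 0 := fun h => h0 (by have := hA v; rw [h, map_zero] at this; simpa using this)
    have h1 := hpos v h0
    have h2 := hpos (A v) hAv0
    have h3 := hK (A v) v
    rw [← hAv, hA, map_neg] at h3
    linarith
  exact ⟨hinj, LinearMap.injective_iff_surjective.1 hinj⟩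

end LinearAlgebra

/-! ### Smooth dependence of the inverse of `J - J*` -/

section Resolvent

variable {n : ℕ}

/-- Multiplication by `i` on `ℂⁿ` as a real-linear map. -/
def mulI (n : ℕ) : Cn n →L[ℝ] Cn n := Complex.I • ContinuousLinearMap.id ℝ (Cn n)

theorem I_smul_I_smul (v : Cn n) : Complex.I • Complex.I • v = -v := by
  rw [smul_smul, Complex.I_mul_I, neg_one_smul]

/-- The complex-linear form `v ↦ l v - i l (i v)` with real part `l`. -/
def complexForm (l : Cn n →L[ℝ] ℝ) : Cn n →L[ℝ] ℂ :=
  Complex.ofRealCLM ∘L l - Complex.I • (Complex.ofRealCLM ∘L (l ∘L mulI n))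

theorem complexForm_apply (l : Cn n →L[ℝ] ℝ) (v : Cn n) :
    complexForm l v = (l v : ℂ) - Complex.I * (l (Complex.I • v) : ℂ) := rfl

theorem complexForm_eq_zero_iff (l : Cn n →L[ℝ] ℝ) (v : Cn n) :
    complexForm l v = 0 ↔ l v = 0 ∧ l (Complex.I • v) = 0 := by
  rw [complexForm_apply]
  refine ⟨fun h => ?_, fun h => by simp [h.1, h.2]⟩
  have h1 := congrArg Complex.re h
  have h2 := congrArg Complex.im h
  simp at h1 h2
  exact ⟨h1, h2⟩

theorem complexForm_I_smul (l : Cn n →L[ℝ] ℝ) (v : Cn n) :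
    complexForm l (Complex.I • v) = Complex.I * complexForm l v := by
  rw [complexForm_apply, complexForm_apply, I_smul_I_smul, map_neg]
  push_cast
  linear_combination (l (Complex.I • v) : ℂ) * Complex.I_sq

theorem complexForm_smul (l : Cn n →L[ℝ] ℝ) (c : ℂ) (v : Cn n) :
    complexForm l (c • v) = c * complexForm l v := by
  have h : c • v = c.re • v + c.im • Complex.I • v := by
    conv_lhs => rw [← Complex.re_add_im c]
    rw [add_smul, mul_smul]
    rfl
  rw [h, map_add, map_smul, map_smul, complexForm_I_smul]
  conv_rhs => rw [← Complex.re_add_im c]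
  simp only [Complex.real_smul]
  ring

/-- The projection onto `ker (complexForm l)` along `ℂ N`. -/
def tangentProj (N : Cn n) (l : Cn n →L[ℝ] ℝ) : Cn n →L[ℝ] Cn n :=
  ContinuousLinearMap.id ℝ (Cn n) -
    ((ContinuousLinearMap.toSpanSingleton ℂ N).restrictScalars ℝ) ∘L
      ((complexForm l N)⁻¹ • complexForm l)

theorem tangentProj_apply (N : Cn n) (l : Cn n →L[ℝ] ℝ) (v : Cn n) :
    tangentProj N l v = v - ((complexForm l N)⁻¹ * complexForm l v) • N := rfl

theorem complexForm_tangentProj {N : Cn n} {l : Cn n →L[ℝ] ℝ} (hN : complexForm l N ≠ 0)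
    (v : Cn n) : complexForm l (tangentProj N l v) = 0 := by
  rw [tangentProj_apply, map_sub, complexForm_smul]
  field_simp
  ring

theorem tangentProj_of_mem {N : Cn n} {l : Cn n →L[ℝ] ℝ} {v : Cn n} (hv : complexForm l v = 0) :
    tangentProj N l v = v := by
  rw [tangentProj_apply, hv, mul_zero, zero_smul, sub_zero]

/-- Precomposition with `P`, as an operator on real-linear forms. -/
def precomp (P : Cn n →L[ℝ] Cn n) : (Cn n →L[ℝ] ℝ) →L[ℝ] (Cn n →L[ℝ] ℝ) :=
  (ContinuousLinearMap.compL ℝ (Cn n) (Cn n) ℝ).flip P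

/-- The pullback `h(P ·, P ·)` of a bilinear form. -/
def pullbackForm (P : Cn n →L[ℝ] Cn n) (h : Cn n →L[ℝ] Cn n →L[ℝ] ℝ) : Cn n →L[ℝ] Cn n →L[ℝ] ℝ :=
  precomp P ∘L h ∘L P

theorem pullbackForm_apply (P : Cn n →L[ℝ] Cn n) (h : Cn n →L[ℝ] Cn n →L[ℝ] ℝ) (v u : Cn n) :
    pullbackForm P h v u = h (P v) (P u) := rfl

/-- The form `h(iv, u) - h(v, iu)` on `ker (complexForm l)`, extended to `ℂⁿ` by means of
`tangentProj`. The two summands with `l` make the extension nondegenerate. -/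
def commutatorForm (N : Cn n) (l : Cn n →L[ℝ] ℝ) (h : Cn n →L[ℝ] Cn n →L[ℝ] ℝ) :
    Cn n →L[ℝ] Cn n →L[ℝ] ℝ :=
  pullbackForm (tangentProj N l) (h ∘L mulI n - precomp (mulI n) ∘L h) +
    l.smulRight l + (l ∘L mulI n).smulRight (l ∘L mulI n)

theorem commutatorForm_apply (N : Cn n) (l : Cn n →L[ℝ] ℝ) (h : Cn n →L[ℝ] Cn n →L[ℝ] ℝ)
    (v u : Cn n) : commutatorForm N l h v u =
      h (Complex.I • tangentProj N l v) (tangentProj N l u) -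
        h (tangentProj N l v) (Complex.I • tangentProj N l u) +
        l v * l u + l (Complex.I • v) * l (Complex.I • u) := rfl

theorem commutatorForm_isInvertible {N : Cn n} {l : Cn n →L[ℝ] ℝ}
    {h : Cn n →L[ℝ] Cn n →L[ℝ] ℝ} (hN : complexForm l N ≠ 0)
    (hdef : ∀ v, complexForm l v = 0 → h v v + h (Complex.I • v) (Complex.I • v) = 0 → v = 0) :
    (commutatorForm N l h).IsInvertible := by
  have hinj : Function.Injective (commutatorForm N l h) := by
    rw [injective_iff_map_eq_zero]
    intro v hv
    have hvu : ∀ u, commutatorForm N l h v u = 0 := fun u => by rw [hv]; rfl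
    have hlv : complexForm l v = 0 := by
      have hker : ∀ u, tangentProj N l u = 0 →
          l v * l u + l (Complex.I • v) * l (Complex.I • u) = 0 := by
        intro u hu
        have := hvu u
        rw [commutatorForm_apply, hu] at this
        simpa using this
      -- Test with the component `c • N` of `v` along `N`.
      set c := (complexForm l N)⁻¹ * complexForm l v with hc
      have hcN : complexForm l (c • N) = complexForm l v := by
        rw [complexForm_smul, hc]
        field_simp
      have h1 := hker (c • N) (by
        rw [tangentProj_apply, hcN, ← hc, sub_self])
      rw [complexForm_apply, complexForm_apply] at hcN
      have h2 := congrArg Complex.re hcN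
      have h3 := congrArg Complex.im hcN
      simp at h2 h3
      rw [h2, h3] at h1
      rw [complexForm_eq_zero_iff]
      constructor <;> nlinarith [mul_self_nonneg (l v), mul_self_nonneg (l (Complex.I • v))]
    have hlI : complexForm l (Complex.I • v) = 0 := by rw [complexForm_I_smul, hlv, mul_zero]
    have h1 := hvu (Complex.I • v)
    rw [commutatorForm_apply, tangentProj_of_mem hlv, tangentProj_of_mem hlI, I_smul_I_smul,
      ((complexForm_eq_zero_iff l v).1 hlv).1, ((complexForm_eq_zero_iff l v).1 hlv).2,
      map_neg] at h1
    exact hdef v hlv (by linarith)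
  have hfr : Module.finrank ℝ (Cn n) = Module.finrank ℝ (Cn n →L[ℝ] ℝ) := by
    rw [← LinearEquiv.finrank_eq (LinearMap.toContinuousLinearMap (𝕜 := ℝ) (E := Cn n) (F' := ℝ))]
    exact Subspace.dual_finrank_eq.symm
  exact ⟨(LinearEquiv.ofInjectiveOfFinrankEq (commutatorForm N l h).toLinearMap hinj
    hfr).toContinuousLinearEquiv, rfl⟩

section Smooth

variable {V : Set (Cn n)} {l : Cn n → Cn n →L[ℝ] ℝ} {h : Cn n → Cn n →L[ℝ] Cn n →L[ℝ] ℝ}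

theorem contDiffOn_complexForm (hl : ContDiffOn ℝ ∞ l V) :
    ContDiffOn ℝ ∞ (fun z => complexForm (l z)) V := by
  unfold complexForm
  exact (contDiffOn_const.clm_comp hl).sub
    ((contDiffOn_const.clm_comp (hl.clm_comp contDiffOn_const)).const_smul Complex.I)

theorem contDiffOn_tangentProj {N : Cn n} (hl : ContDiffOn ℝ ∞ l V)
    (hN : ∀ z ∈ V, complexForm (l z) N ≠ 0) :
    ContDiffOn ℝ ∞ (fun z => tangentProj N (l z)) V := by
  unfold tangentProj
  have hc := contDiffOn_complexForm hl
  exact contDiffOn_const.sub (contDiffOn_const.clm_comp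
    (((hc.clm_apply contDiffOn_const).inv hN).smul hc))

theorem contDiffOn_pullbackForm {P : Cn n → Cn n →L[ℝ] Cn n} (hP : ContDiffOn ℝ ∞ P V)
    (hh : ContDiffOn ℝ ∞ h V) : ContDiffOn ℝ ∞ (fun z => pullbackForm (P z) (h z)) V := by
  unfold pullbackForm precomp
  exact ((ContinuousLinearMap.compL ℝ (Cn n) (Cn n) ℝ).flip.contDiff.comp_contDiffOn hP).clm_comp
    (hh.clm_comp hP)

theorem contDiffOn_commutatorForm {N : Cn n} (hl : ContDiffOn ℝ ∞ l V) (hh : ContDiffOn ℝ ∞ h V)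
    (hN : ∀ z ∈ V, complexForm (l z) N ≠ 0) :
    ContDiffOn ℝ ∞ (fun z => commutatorForm N (l z) (h z)) V := by
  unfold commutatorForm
  have hli : ContDiffOn ℝ ∞ (fun z => l z ∘L mulI n) V := hl.clm_comp contDiffOn_const
  exact ((contDiffOn_pullbackForm (contDiffOn_tangentProj hl hN)
    ((hh.clm_comp contDiffOn_const).sub (contDiffOn_const.clm_comp hh))).add
      (hl.smulRight hl)).add (hli.smulRight hli)

/-- Smooth dependence on the point of the linear form `x ↦ dF(i k) - i dF(k)` on the complex tangent
space, where `k = (J - J*)⁻¹ x` is determined by `Hess r (x, u) = Hess r (i k, u) - Hess r (k, i u)`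
for all `u` in the complex tangent space. -/
theorem exists_smooth_solution {r : Cn n → ℝ} {F : Cn n → ℂ} {z₀ : Cn n} (hV : IsOpen V)
    (hz₀ : z₀ ∈ V) (hr : ContDiffOn ℝ ∞ r V) (hF : ContDiffOn ℝ ∞ F V) (hdr : fderiv ℝ r z₀ ≠ 0)
    (hdef : ∀ v, fderiv ℝ r z₀ v = 0 → fderiv ℝ r z₀ (Complex.I • v) = 0 →
      fderiv ℝ (fderiv ℝ r) z₀ v v +
        fderiv ℝ (fderiv ℝ r) z₀ (Complex.I • v) (Complex.I • v) = 0 → v = 0) :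
    ∃ (V' : Set (Cn n)) (b : Cn n → Cn n →L[ℝ] ℂ), IsOpen V' ∧ z₀ ∈ V' ∧ V' ⊆ V ∧
      ContDiffOn ℝ ∞ b V' ∧ ∀ z ∈ V', ∀ x k : Cn n,
        fderiv ℝ r z x = 0 → fderiv ℝ r z (Complex.I • x) = 0 →
        fderiv ℝ r z k = 0 → fderiv ℝ r z (Complex.I • k) = 0 →
        (∀ u, fderiv ℝ r z u = 0 → fderiv ℝ r z (Complex.I • u) = 0 →
          fderiv ℝ (fderiv ℝ r) z x u = fderiv ℝ (fderiv ℝ r) z (Complex.I • k) u -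
            fderiv ℝ (fderiv ℝ r) z k (Complex.I • u)) →
        b z x = fderiv ℝ F z (Complex.I • k) - Complex.I * fderiv ℝ F z k := by
  obtain ⟨N, hN⟩ : ∃ N, complexForm (fderiv ℝ r z₀) N ≠ 0 := by
    by_contra! h
    exact hdr (ContinuousLinearMap.ext fun v => ((complexForm_eq_zero_iff _ v).1 (h v)).1)
  have hl : ContDiffOn ℝ ∞ (fderiv ℝ r) V := hr.fderiv_of_isOpen hV (by simp)
  have hh : ContDiffOn ℝ ∞ (fderiv ℝ (fderiv ℝ r)) V := hl.fderiv_of_isOpen hV (by simp)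
  have hdF : ContDiffOn ℝ ∞ (fderiv ℝ F) V := hF.fderiv_of_isOpen hV (by simp)
  set V₁ : Set (Cn n) := V ∩ {z | complexForm (fderiv ℝ r z) N ≠ 0} with hV₁
  have hV₁o : IsOpen V₁ :=
    ((contDiffOn_complexForm hl).clm_apply contDiffOn_const).continuousOn.isOpen_inter_preimage hV
      isOpen_ne
  have hVV₁ : V₁ ⊆ V := inter_subset_left
  set Ω : Cn n → Cn n →L[ℝ] Cn n →L[ℝ] ℝ :=
    fun z => commutatorForm N (fderiv ℝ r z) (fderiv ℝ (fderiv ℝ r) z) with hΩ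
  have hΩc : ContDiffOn ℝ ∞ Ω V₁ :=
    contDiffOn_commutatorForm (hl.mono hVV₁) (hh.mono hVV₁) fun z hz => hz.2
  set V₂ : Set (Cn n) := V₁ ∩ Ω ⁻¹' range ((↑) : (Cn n ≃L[ℝ] (Cn n →L[ℝ] ℝ)) → _) with hV₂
  have hV₂o : IsOpen V₂ :=
    hΩc.continuousOn.isOpen_inter_preimage hV₁o (ContinuousLinearEquiv.isOpen)
  have hV₂V₁ : V₂ ⊆ V₁ := inter_subset_left
  have hinv : ContDiffOn ℝ ∞ (fun z => ContinuousLinearMap.inverse (Ω z)) V₂ := by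
    intro z hz
    obtain ⟨e, he⟩ := hz.2
    have h1 : ContDiffAt ℝ ∞ ContinuousLinearMap.inverse (Ω z) := by
      rw [← he]
      exact contDiffAt_map_inverse e
    exact h1.comp_contDiffWithinAt z (hΩc.mono hV₂V₁ z hz)
  have hP := contDiffOn_tangentProj (hl.mono hVV₁) fun z hz => hz.2
  refine ⟨V₂, fun z => (fderiv ℝ F z ∘L mulI n - Complex.I • fderiv ℝ F z) ∘L
    (ContinuousLinearMap.inverse (Ω z) ∘L
      pullbackForm (tangentProj N (fderiv ℝ r z)) (fderiv ℝ (fderiv ℝ r) z)), hV₂o,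
    ⟨⟨hz₀, hN⟩, ?_⟩, hV₂V₁.trans hVV₁, ?_, ?_⟩
  · obtain ⟨e, he⟩ := commutatorForm_isInvertible hN fun v hv =>
      hdef v ((complexForm_eq_zero_iff _ v).1 hv).1 ((complexForm_eq_zero_iff _ v).1 hv).2
    exact ⟨e, he⟩
  · have hdF' := hdF.mono (hV₂V₁.trans hVV₁)
    exact ((hdF'.clm_comp contDiffOn_const).sub (hdF'.const_smul Complex.I)).clm_comp
      (hinv.clm_comp ((contDiffOn_pullbackForm hP (hh.mono hVV₁)).mono hV₂V₁))
  · rintro z ⟨⟨hzV, hzN⟩, e, he⟩ x k hx hIx hk hIk hxk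
    have hx' := (complexForm_eq_zero_iff _ x).2 ⟨hx, hIx⟩
    have hk' := (complexForm_eq_zero_iff _ k).2 ⟨hk, hIk⟩
    have hsolve : pullbackForm (tangentProj N (fderiv ℝ r z)) (fderiv ℝ (fderiv ℝ r) z) x =
        Ω z k := by
      ext u
      have hu := (complexForm_eq_zero_iff _ _).1 (complexForm_tangentProj hzN u)
      rw [pullbackForm_apply, hΩ, commutatorForm_apply, tangentProj_of_mem hx',
        tangentProj_of_mem hk', hk, hIk, hxk _ hu.1 hu.2]
      ring
    have hk0 : ContinuousLinearMap.inverse (Ω z) (Ω z k) = k := by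
      rw [← he, ContinuousLinearMap.inverse_equiv]
      simp
    change (fderiv ℝ F z ∘L mulI n - Complex.I • fderiv ℝ F z)
      (ContinuousLinearMap.inverse (Ω z) (pullbackForm _ _ x)) = _
    rw [hsolve, hk0]
    rfl

end Smooth

end Resolvent

/-! ### Existence and uniqueness of the projective dual structure -/

section DualStructure

variable {n : ℕ} {S : Set (CP n)} {p : CP n} {ρ : CP n → ℝ}

theorem JH_JH (v : H S p) : JH S p (JH S p v) = -v := Subtype.ext (J_J p v)

/-- `K` is the adjoint of `J` on `H_p S` with respect to the Hessians of the local defining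
functions of `S` in affine coordinates. -/
def IsHessianAdjoint (S : Set (CP n)) (p : CP n) (K : H S p →ₗ[ℝ] H S p) : Prop :=
  ∀ (g : Cn1 n ≃ₗ[ℂ] Cn1 n) (ρ : CP n → ℝ), p ∈ affineDomain g → IsLocalDefiningFunction S p ρ →
    ∀ u v : H S p, chartHessian g ρ p (K v) u = chartHessian g ρ p v (J p u)

theorem exists_isHessianAdjoint (hS : IsStronglyCConvex S) (hp : p ∈ S) :
    ∃ K : H S p →ₗ[ℝ] H S p, IsHessianAdjoint S p K ∧ (∀ v, K (K v) = -v) ∧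
      Function.Bijective (JH S p - K) := by
  obtain ⟨g, ρ, hg, hρ, hpos⟩ := exists_chartHessian_pos hS hp
  have : FiniteDimensional ℝ (TCP p) := inferInstanceAs (FiniteDimensional ℝ (Cn n))
  let B : LinearMap.BilinForm ℝ (H S p) := (chartHessian g ρ p).restrict (H S p)
  have hB : ∀ v, v ≠ 0 → 0 < B v v := fun v hv =>
    hpos v v.2 fun h => hv (Subtype.ext h)
  obtain ⟨K, hK⟩ := exists_adjoint hB (JH S p)
  refine ⟨K, fun g' ρ' hg' hρ' u v => ?_, fun v => ?_, bijective_sub_adjoint hB JH_JH hK⟩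
  · obtain ⟨c, -, hc⟩ := exists_chartHessian_eq_mul hp hρ hρ' hg hg'
    rw [hc _ (K v).2 _ u.2, hc _ v.2 _ (J_mem_H u.2)]
    exact congrArg (c * ·) (hK u v)
  · by_contra h
    have h0 := hB (K (K v) + v) fun h' => h (eq_neg_of_add_eq_zero_left h')
    have h1 : ∀ u, B (K (K v) + v) u = 0 := by
      intro u
      rw [map_add, LinearMap.add_apply, hK, hK, JH_JH, map_neg, neg_add_cancel]
    exact h0.ne' (h1 _)

theorem differential_w (hρ : IsLocalDefiningFunction S p ρ) {g : Cn1 n ≃ₗ[ℂ] Cn1 n}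
    (hg : p ∈ affineDomain g) (hD : denom (ρ ∘ affinePoint g) (affineCoord g p) ≠ 0) (j : Fin n)
    (v : TCP p) : differential (w g ρ j) p v =
      fderiv ℝ (dualCoord (ρ ∘ affinePoint g) j) (affineCoord g p) (coordDifferential g p v) := by
  have h : w g ρ j ∘ affinePoint g = dualCoord (ρ ∘ affinePoint g) j := by
    funext z
    simp [w, affineCoord_affinePoint]
  have h1 := mfderiv_eq_fderiv_comp g hg (f := w g ρ j)
    (by rw [h]; exact differentiableAt_dualCoord (hρ.contDiffAt hg) hD j) v
  rw [h] at h1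
  exact h1

/-- The functions `wⱼ` satisfy `dwⱼ(x) = i dwⱼ(v)` for all `j` if and only if the Hessian satisfies
`h(x, u) = h(v, J u)` for all `u` in `H_p S`. -/
theorem differential_w_eq_I_mul_iff (hp : p ∈ S) (hρ : IsLocalDefiningFunction S p ρ)
    {g : Cn1 n ≃ₗ[ℂ] Cn1 n} (hg : p ∈ affineDomain g)
    (hD : denom (ρ ∘ affinePoint g) (affineCoord g p) ≠ 0) (x v : H S p) :
    (∀ j, differential (w g ρ j) p x = Complex.I * differential (w g ρ j) p v) ↔
      ∀ u : H S p, chartHessian g ρ p x u = chartHessian g ρ p v (J p u) := by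
  have hker : ∀ y : H S p, ∑ j, coordDifferential g p y j *
      wirtinger (ρ ∘ affinePoint g) j (affineCoord g p) = 0 := fun y =>
    sum_wirtinger_eq_zero ((mem_H_iff_fderiv hp hρ hg y).1 y.2).1
      ((mem_H_iff_fderiv hp hρ hg y).1 y.2).2
  simp only [differential_w hρ hg hD]
  rw [fderiv_dualCoord_eq_I_mul_iff (hρ.contDiffAt hg) hD (hker x) (hker v)]
  simp only [chartHessian_apply, coordDifferential_J g hg]
  refine ⟨fun h u => h _ (hker u), fun h u hu => ?_⟩
  obtain ⟨h1, h2⟩ := eq_zero_of_sum_wirtinger hu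
  obtain ⟨y, hy, rfl⟩ := exists_mem_H_of_fderiv hp hρ hg h1 h2
  exact h ⟨y, hy⟩

/-- The homogeneous coordinate change that translates the affine coordinates by `b`. -/
def shear (b : Cn n) : Cn1 n ≃ₗ[ℂ] Cn1 n where
  toFun Z := Z + Z 0 • Fin.cons 0 b
  invFun Z := Z - Z 0 • Fin.cons 0 b
  map_add' Z Z' := by
    simp only [Pi.add_apply, add_smul]
    abel
  map_smul' c Z := by
    simp only [Pi.smul_apply, smul_eq_mul, RingHom.id_apply, smul_add, mul_smul]
  left_inv Z := by simp
  right_inv Z := by simp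

/-- Some affine coordinates around `p` have a complex tangent hyperplane at `p` that does not pass
through the origin. -/
theorem exists_denom_ne_zero (hρ : IsLocalDefiningFunction S p ρ) :
    ∃ g : Cn1 n ≃ₗ[ℂ] Cn1 n, p ∈ affineDomain g ∧
      denom (ρ ∘ affinePoint g) (affineCoord g p) ≠ 0 := by
  obtain ⟨g, hg⟩ := exists_mem_affineDomain p
  obtain ⟨y, hy⟩ : ∃ y : Cn n, ∑ j, y j *
      wirtinger (ρ ∘ affinePoint g) j (affineCoord g p) ≠ 0 := by
    by_contra! h
    exact hρ.fderiv_ne_zero hg (ContinuousLinearMap.ext fun u => (eq_zero_of_sum_wirtinger (h u)).1)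
  -- Translate the coordinates so that `p` gets the coordinates `y`.
  set b : Cn n := y - affineCoord g p with hb
  have hpt : ∀ z, affinePoint (g.trans (shear b)) z = affinePoint g (z - b) := by
    intro z
    unfold affinePoint
    congr 1
    rw [LinearEquiv.trans_symm, LinearEquiv.trans_apply]
    congr 1
    change (Fin.cons 1 z : Cn1 n) - (Fin.cons 1 z : Cn1 n) 0 • Fin.cons 0 b = _
    funext i
    refine Fin.cases ?_ (fun j => ?_) i <;> simp
  have hp1 : affinePoint (g.trans (shear b)) y = p := by
    rw [hpt, hb, sub_sub_cancel, affinePoint_affineCoord g p hg]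
  have hy1 : affineCoord (g.trans (shear b)) p = y := by
    rw [← hp1, affineCoord_affinePoint]
  refine ⟨g.trans (shear b), hp1 ▸ affinePoint_mem _ y, ?_⟩
  rw [hy1]
  have hcomp : ρ ∘ affinePoint (g.trans (shear b)) = fun z => (ρ ∘ affinePoint g) (z - b) := by
    funext z
    simp [hpt]
  have hw : ∀ j, wirtinger (ρ ∘ affinePoint (g.trans (shear b))) j y =
      wirtinger (ρ ∘ affinePoint g) j (affineCoord g p) := by
    intro j
    unfold wirtinger
    rw [hcomp, fderiv_comp_sub, hb, sub_sub_cancel]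
  simpa only [denom, hw] using hy

theorem isProjectiveDualStructure_of_isHessianAdjoint {K : ∀ p : S, H S p →ₗ[ℝ] H S p}
    (hK : ∀ p : S, IsHessianAdjoint S p (K p)) (hK2 : ∀ (p : S) v, K p (K p v) = -v) :
    IsProjectiveDualStructure S K := fun p =>
  ⟨hK2 p, fun g ρ hg hρ hD j v => (differential_w_eq_I_mul_iff p.2 hρ hg hD (K p v) v).2
    (fun u => hK p g ρ hg hρ u v) j⟩

theorem isProjectiveDualStructure_unique (hS : IsStronglyCConvex S)
    {K K' : ∀ p : S, H S p →ₗ[ℝ] H S p} (hK : IsProjectiveDualStructure S K)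
    (hK' : IsProjectiveDualStructure S K') : K' = K := by
  funext p
  refine LinearMap.ext fun v => ?_
  obtain ⟨g₀, ρ₀, hg₀, hρ₀, hpos⟩ := exists_chartHessian_pos hS p.2
  obtain ⟨g, hg, hD⟩ := exists_denom_ne_zero hρ₀
  obtain ⟨c, hc0, hc⟩ := exists_chartHessian_eq_mul p.2 hρ₀ hρ₀ hg₀ hg
  have h1 := (differential_w_eq_I_mul_iff p.2 hρ₀ hg hD (K p v) v).1
    fun j => (hK p).2 g ρ₀ hg hρ₀ hD j v
  have h2 := (differential_w_eq_I_mul_iff p.2 hρ₀ hg hD (K' p v) v).1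
    fun j => (hK' p).2 g ρ₀ hg hρ₀ hD j v
  by_contra h
  set x := K' p v - K p v with hx
  have h3 : chartHessian g ρ₀ p x x = 0 := by
    have : (x : TCP (p : CP n)) = (K' p v : TCP (p : CP n)) - K p v := rfl
    nth_rewrite 1 [this]
    rw [map_sub, LinearMap.sub_apply, h1, h2, sub_self]
  rw [hc _ x.2 _ x.2] at h3
  exact (hpos x x.2 fun h' => h (sub_eq_zero.1 (Subtype.ext h'))).ne'
    ((mul_eq_zero.1 h3).resolve_left hc0)

end DualStructure

/-! ### Differentials along the hypersurface and smoothness of the components -/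

section Differentials

variable {n : ℕ} {S : Set (CP n)}

theorem IsLocalExtension.contDiffOn {u : S → ℂ} {p : CP n} {U : Set (CP n)} {f : CP n → ℂ}
    (hf : IsLocalExtension S u p U f) (g : Cn1 n ≃ₗ[ℂ] Cn1 n) :
    ContDiffOn ℝ ∞ (f ∘ affinePoint g) (affinePoint g ⁻¹' U) :=
  contDiffOn_comp_affinePoint g hf.2.2.1

theorem IsLocalExtension.contDiffAt {u : S → ℂ} {p : CP n} {U : Set (CP n)} {f : CP n → ℂ}
    (hf : IsLocalExtension S u p U f) {g : Cn1 n ≃ₗ[ℂ] Cn1 n} (hg : p ∈ affineDomain g) :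
    ContDiffAt ℝ 2 (f ∘ affinePoint g) (affineCoord g p) := by
  refine ((hf.contDiffOn g).contDiffAt
    ((hf.1.preimage (continuous_affinePoint g)).mem_nhds ?_)).of_le ENat.LEInfty.out
  rw [mem_preimage, affinePoint_affineCoord g p hg]
  exact hf.2.1

theorem IsLocalExtension.differential_apply {u : S → ℂ} {p : CP n} {U : Set (CP n)} {f : CP n → ℂ}
    (hf : IsLocalExtension S u p U f) {g : Cn1 n ≃ₗ[ℂ] Cn1 n} (hg : p ∈ affineDomain g)
    (v : TCP p) : differential f p v =
      fderiv ℝ (f ∘ affinePoint g) (affineCoord g p) (coordDifferential g p v) :=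
  mfderiv_eq_fderiv_comp g hg ((hf.contDiffAt hg).differentiableAt (by norm_num)) v

/-- The differential of a smooth extension of `u` on `H_p S` does not depend on the extension. -/
theorem differential_eq_of_isLocalExtension (hS : IsSmoothHypersurface S) {u : S → ℂ} {p : CP n}
    (hp : p ∈ S) {U U' : Set (CP n)} {f f' : CP n → ℂ} (hf : IsLocalExtension S u p U f)
    (hf' : IsLocalExtension S u p U' f') (v : H S p) :
    differential f p v = differential f' p v := by
  obtain ⟨ρ, hρ⟩ := hS p hp
  obtain ⟨g, hg⟩ := exists_mem_affineDomain p
  have hv := ((mem_H_iff hp hρ v).1 v.2).1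
  have h0 : ∀ᶠ q in 𝓝 p, q ∈ S → f q - f' q = 0 := by
    filter_upwards [hf.1.mem_nhds hf.2.1, hf'.1.mem_nhds hf'.2.1] with q h1 h2 hq
    rw [hf.2.2.2 ⟨q, hq⟩ h1, hf'.2.2.2 ⟨q, hq⟩ h2, sub_self]
  have hd := (hf.contDiffAt hg).sub (hf'.contDiffAt hg)
  have hpart : ∀ L : ℂ →L[ℝ] ℝ, L (differential f p v - differential f' p v) = 0 := by
    intro L
    have h1 := fderiv_eq_zero_of_vanishing hp hρ hg (f := fun q => L (f q - f' q))
      (L.contDiff.contDiffAt.comp _ hd)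
      (by filter_upwards [h0] with q h hq; rw [h hq, map_zero]) hv
    have h2 : HasFDerivAt ((fun q => L (f q - f' q)) ∘ affinePoint g) _ (affineCoord g p) :=
      L.hasFDerivAt.comp _ ((((hf.contDiffAt hg).differentiableAt (by norm_num)).hasFDerivAt).sub
        (((hf'.contDiffAt hg).differentiableAt (by norm_num)).hasFDerivAt))
    rw [h2.fderiv] at h1
    rw [hf.differential_apply hg, hf'.differential_apply hg]
    exact h1
  rw [← sub_eq_zero]
  exact Complex.ext (hpart Complex.reCLM) (hpart Complex.imCLM)

/-- The restriction `du|_H`, defined by a choice of a smooth local extension of `u` around each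
point. -/
def restrictedDifferential (u : SmoothFunctions S) (p : S) : H S p →ₗ[ℝ] ℂ :=
  differential (u.2 p).choose_spec.choose p ∘ₗ (H S p).subtype

theorem restrictedDifferential_apply (hS : IsSmoothHypersurface S) {u : SmoothFunctions S} {p : S}
    {U : Set (CP n)} {f : CP n → ℂ} (hf : IsLocalExtension S u p U f) (v : H S p) :
    restrictedDifferential u p v = differential f p v :=
  differential_eq_of_isLocalExtension hS p.2 (u.2 p).choose_spec.choose_spec hf v

theorem isDifferentialOnH_iff (hS : IsSmoothHypersurface S) (u : SmoothFunctions S)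
    (α : ∀ p : S, H S p →ₗ[ℝ] ℂ) :
    IsDifferentialOnH S u α ↔ α = restrictedDifferential u := by
  constructor
  · intro h
    funext p
    obtain ⟨U, f, hf⟩ := u.2 p
    exact LinearMap.ext fun v => by rw [h p U f hf v, restrictedDifferential_apply hS hf]
  · rintro rfl p U f hf v
    exact restrictedDifferential_apply hS hf v

theorem restrictedDifferential_add (hS : IsSmoothHypersurface S) (u v : SmoothFunctions S) :
    restrictedDifferential (u + v) = restrictedDifferential u + restrictedDifferential v := by
  funext p
  refine LinearMap.ext fun x => ?_
  obtain ⟨U, f, hf⟩ := u.2 p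
  obtain ⟨U', f', hf'⟩ := v.2 p
  obtain ⟨g, hg⟩ := exists_mem_affineDomain (p : CP n)
  have hsum : IsLocalExtension S (u + v : SmoothFunctions S) p (U ∩ U') (fun q => f q + f' q) :=
    ⟨hf.1.inter hf'.1, ⟨hf.2.1, hf'.2.1⟩, (hf.2.2.1.mono inter_subset_left).add
      (hf'.2.2.1.mono inter_subset_right),
      fun q hq => by simp [hf.2.2.2 q hq.1, hf'.2.2.2 q hq.2]⟩
  rw [restrictedDifferential_apply hS hsum, Pi.add_apply, LinearMap.add_apply,
    restrictedDifferential_apply hS hf, restrictedDifferential_apply hS hf',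
    hsum.differential_apply hg, hf.differential_apply hg, hf'.differential_apply hg]
  have h2 := ((((hf.contDiffAt hg).differentiableAt (by norm_num)).hasFDerivAt).add
        (((hf'.contDiffAt hg).differentiableAt (by norm_num)).hasFDerivAt)).fderiv
  exact congrArg (fun L : Cn n →L[ℝ] ℂ => L (coordDifferential g p x)) h2

theorem restrictedDifferential_smul (hS : IsSmoothHypersurface S) (c : ℂ)
    (u : SmoothFunctions S) :
    restrictedDifferential (c • u) = c • restrictedDifferential u := by
  funext p
  refine LinearMap.ext fun x => ?_
  obtain ⟨U, f, hf⟩ := u.2 p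
  obtain ⟨g, hg⟩ := exists_mem_affineDomain (p : CP n)
  have hsmul : IsLocalExtension S (c • u : SmoothFunctions S) p U (fun q => c • f q) :=
    ⟨hf.1, hf.2.1, (contDiff_id.const_smul c :
      ContDiff ℝ ∞ fun x : ℂ => c • x).contMDiff.comp_contMDiffOn hf.2.2.1,
      fun q hq => by simp [hf.2.2.2 q hq]⟩
  rw [restrictedDifferential_apply hS hsmul, Pi.smul_apply, LinearMap.smul_apply,
    restrictedDifferential_apply hS hf, hsmul.differential_apply hg, hf.differential_apply hg]
  have h2 := (((hf.contDiffAt hg).differentiableAt (by norm_num)).hasFDerivAt.const_smul c).fderiv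
  exact congrArg (fun L : Cn n →L[ℝ] ℂ => L (coordDifferential g p x)) h2

/-- A family of linear maps is an `H`-form if it has smooth coefficients in terms of the affine
coordinates. -/
theorem mem_HForms_of_coefficients {α : ∀ p : S, H S p →ₗ[ℝ] ℂ}
    (h : ∀ (p : S) (g : Cn1 n ≃ₗ[ℂ] Cn1 n), (p : CP n) ∈ affineDomain g →
      ∃ (V : Set (Cn n)) (b : Cn n → Cn n →L[ℝ] ℂ), IsOpen V ∧ affineCoord g p ∈ V ∧
        ContDiffOn ℝ ∞ b V ∧ ∀ q : S, (q : CP n) ∈ affineDomain g → affineCoord g q ∈ V →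
          ∀ v : H S q, α q v = b (affineCoord g q) (coordDifferential g q v)) :
    α ∈ HForms S := by
  intro p g hg
  obtain ⟨V, b, hV, hpV, hb, hα⟩ := h p g hg
  refine ⟨affineDomain g ∩ affineCoord g ⁻¹' V, b ∘ affineCoord g,
    (continuousOn_affineCoord g).isOpen_inter_preimage (isOpen_affineDomain g) hV, ⟨hg, hpV⟩,
    inter_subset_left, ?_, fun q hq v => hα q hq.1 hq.2 v⟩
  exact hb.contMDiffOn.comp ((contMDiffOn_affineCoord g).mono inter_subset_left) fun q hq => hq.2

/-- Near `p`, a single function `ρ` is a local defining function at all points of `S`, and a single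
function `f` is a smooth extension of `u` around all of them. -/
theorem exists_local_data (hS : IsSmoothHypersurface S) (u : SmoothFunctions S) (p : S)
    {g : Cn1 n ≃ₗ[ℂ] Cn1 n} (hg : (p : CP n) ∈ affineDomain g) :
    ∃ (V : Set (Cn n)) (ρ : CP n → ℝ) (f : CP n → ℂ), IsOpen V ∧ affineCoord g p ∈ V ∧
      ContDiffOn ℝ ∞ (ρ ∘ affinePoint g) V ∧ ContDiffOn ℝ ∞ (f ∘ affinePoint g) V ∧
      ∀ q : S, (q : CP n) ∈ affineDomain g → affineCoord g q ∈ V →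
        IsLocalDefiningFunction S q ρ ∧ ∃ U, IsLocalExtension S u q U f := by
  obtain ⟨ρ, hρ⟩ := hS p p.2
  obtain ⟨U, hU, hpU, hρU, hSU, -⟩ := id hρ
  obtain ⟨W, f, hf⟩ := u.2 p
  have hr := contDiffOn_comp_affinePoint g hρU
  have hUo := hU.preimage (continuous_affinePoint g)
  have hWo := hf.1.preimage (continuous_affinePoint g)
  have hdr := hr.fderiv_of_isOpen (m := ∞) hUo (by simp)
  have hpp := affinePoint_affineCoord g p hg
  refine ⟨(affinePoint g ⁻¹' U ∩ fderiv ℝ (ρ ∘ affinePoint g) ⁻¹' {0}ᶜ) ∩ affinePoint g ⁻¹' W,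
    ρ, f, (hdr.continuousOn.isOpen_inter_preimage hUo isOpen_compl_singleton).inter hWo,
    ⟨⟨by rwa [mem_preimage, hpp], hρ.fderiv_ne_zero hg⟩, by rw [mem_preimage, hpp]; exact hf.2.1⟩,
    hr.mono fun z hz => hz.1.1, (hf.contDiffOn g).mono fun z hz => hz.2, ?_⟩
  rintro q hqg ⟨⟨hqU, hqd⟩, hqW⟩
  rw [mem_preimage, affinePoint_affineCoord g q hqg] at hqU hqW
  refine ⟨⟨U, hU, hqU, hρU, hSU, fun h => hqd ?_⟩, W, hf.1, hqW, hf.2.2⟩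
  have hd : DifferentiableAt ℝ (ρ ∘ affinePoint g) (affineCoord g q) :=
    (hr.contDiffAt (hUo.mem_nhds
      (by rwa [mem_preimage, affinePoint_affineCoord g q hqg]))).differentiableAt (by simp)
  refine ContinuousLinearMap.ext fun x => ?_
  obtain ⟨v, rfl⟩ := (coordDifferential_bijective g hqg).2 x
  rw [← mfderiv_eq_fderiv_comp g hqg hd, h]
  rfl

theorem restrictedDifferential_mem_HForms (hS : IsSmoothHypersurface S) (u : SmoothFunctions S) :
    restrictedDifferential u ∈ HForms S := by
  refine mem_HForms_of_coefficients fun p g hg => ?_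
  obtain ⟨V, ρ, f, hV, hpV, -, hf, h⟩ := exists_local_data hS u p hg
  refine ⟨V, fderiv ℝ (f ∘ affinePoint g), hV, hpV, hf.fderiv_of_isOpen hV (by simp),
    fun q hqg hqV v => ?_⟩
  obtain ⟨U, hfU⟩ := (h q hqg hqV).2
  rw [restrictedDifferential_apply hS hfU, hfU.differential_apply hqg]

/-- The `J*`-linear component of `du|_H` varies smoothly. -/
theorem dualPart_mem_HForms (hS : IsStronglyCConvex S) {K : ∀ p : S, H S p →ₗ[ℝ] H S p}
    (hK : ∀ p : S, IsHessianAdjoint S p (K p)) (hbij : ∀ p : S, Function.Bijective (JH S p - K p))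
    (u : SmoothFunctions S) {β : ∀ p : S, H S p →ₗ[ℝ] ℂ}
    (hβ : ∀ (p : S) (k : H S p), β p (JH S p k - K p k) =
      restrictedDifferential u p (JH S p k) - Complex.I * restrictedDifferential u p k) :
    β ∈ HForms S := by
  refine mem_HForms_of_coefficients fun p g hg => ?_
  obtain ⟨V, ρ, f, hV, hpV, hr, hf, h⟩ := exists_local_data hS.1 u p hg
  have hρ := (h p hg hpV).1
  have hdef : ∀ v, fderiv ℝ (ρ ∘ affinePoint g) (affineCoord g p) v = 0 →
      fderiv ℝ (ρ ∘ affinePoint g) (affineCoord g p) (Complex.I • v) = 0 →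
      fderiv ℝ (fderiv ℝ (ρ ∘ affinePoint g)) (affineCoord g p) v v +
        fderiv ℝ (fderiv ℝ (ρ ∘ affinePoint g)) (affineCoord g p) (Complex.I • v)
          (Complex.I • v) = 0 → v = 0 := by
    intro v h1 h2 h3
    obtain ⟨y, hy, rfl⟩ := exists_mem_H_of_fderiv p.2 hρ hg h1 h2
    rw [← coordDifferential_J g hg, ← chartHessian_apply, ← chartHessian_apply] at h3
    obtain ⟨g₀, ρ₀, hg₀, hρ₀, hpos⟩ := exists_chartHessian_pos hS p.2
    obtain ⟨c, hc0, hc⟩ := exists_chartHessian_eq_mul p.2 hρ₀ hρ hg₀ hg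
    rw [hc y hy y hy, hc _ (J_mem_H hy) _ (J_mem_H hy), ← mul_add] at h3
    have h4 := (mul_eq_zero.1 h3).resolve_left hc0
    by_contra hne
    have hy0 : y ≠ 0 := fun h => hne (by rw [h, map_zero])
    have hJy0 : J (p : CP n) y ≠ 0 := fun h => hy0 (by
      have := J_J (p : CP n) y
      rw [h, map_zero] at this
      exact neg_eq_zero.1 this.symm)
    linarith [hpos y hy hy0, hpos _ (J_mem_H hy) hJy0]
  obtain ⟨V', b, hV', hpV', hV'V, hb, hbz⟩ :=
    exists_smooth_solution hV hpV hr hf (hρ.fderiv_ne_zero hg) hdef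
  refine ⟨V', b, hV', hpV', hb, fun q hqg hqV v => ?_⟩
  obtain ⟨hρq, U, hfU⟩ := h q hqg (hV'V hqV)
  obtain ⟨k, hk⟩ := (hbij q).2 v
  have hk' : (v : TCP (q : CP n)) = J (q : CP n) k - K q k := by rw [← hk]; rfl
  have hv1 := (mem_H_iff_fderiv q.2 hρq hqg v).1 v.2
  have hk1 := (mem_H_iff_fderiv q.2 hρq hqg k).1 k.2
  rw [hbz _ hqV _ (coordDifferential g q k) hv1.1 hv1.2 hk1.1 hk1.2, ← coordDifferential_J g hqg,
    ← hfU.differential_apply hqg, ← hfU.differential_apply hqg]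
  · rw [← hk, LinearMap.sub_apply, hβ, restrictedDifferential_apply hS.1 hfU,
      restrictedDifferential_apply hS.1 hfU]
    rfl
  · intro x h1 h2
    obtain ⟨y, hy, rfl⟩ := exists_mem_H_of_fderiv q.2 hρq hqg h1 h2
    rw [← coordDifferential_J g hqg, ← coordDifferential_J g hqg, ← chartHessian_apply,
      ← chartHessian_apply, ← chartHessian_apply, hk', map_sub, LinearMap.sub_apply,
      hK q g ρ hqg hρq ⟨y, hy⟩ k]

end Differentials

/-! ### Splitting a linear form into a `J`-linear and a `J*`-linear part -/

section Decomposition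

variable {V : Type*} [AddCommGroup V] [Module ℝ V]

theorem decomposition_unique {A K : V →ₗ[ℝ] V} (hbij : Function.Bijective (A - K))
    {α β α' β' : V →ₗ[ℝ] ℂ} (h : α + β = α' + β') (hα : ∀ v, α (A v) = Complex.I * α v)
    (hα' : ∀ v, α' (A v) = Complex.I * α' v) (hβ : ∀ v, β (K v) = Complex.I * β v)
    (hβ' : ∀ v, β' (K v) = Complex.I * β' v) : α = α' ∧ β = β' := by
  have hsum : ∀ v, α v + β v = α' v + β' v := fun v => LinearMap.congr_fun h v
  have hαα : α = α' := by
    refine LinearMap.ext fun x => ?_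
    obtain ⟨v, rfl⟩ := hbij.2 x
    -- `(α - α') ∘ A = i (α - α') = i (β' - β) = (β' - β) ∘ K = (α - α') ∘ K`.
    simp only [LinearMap.sub_apply, map_sub, hα, hα']
    linear_combination (-1 : ℂ) * hsum (K v) + Complex.I * hsum v + hβ v - hβ' v
  exact ⟨hαα, by rw [hαα] at h; exact add_left_cancel h⟩

/-- The `K`-linear part of `γ` is `β = (γ ∘ A - i γ) ∘ (A - K)⁻¹`. It is forced by applying
`γ = α + β` to `A v`, and it is `K`-linear because `K (A - K) = -(A - K) A`. -/
theorem exists_dualPart {A K : V →ₗ[ℝ] V} (hA : ∀ v, A (A v) = -v) (hK : ∀ v, K (K v) = -v)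
    (hbij : Function.Bijective (A - K)) (γ : V →ₗ[ℝ] ℂ) :
    ∃ β : V →ₗ[ℝ] ℂ, (∀ k, β (A k - K k) = γ (A k) - Complex.I * γ k) ∧
      (∀ v, β (K v) = Complex.I * β v) ∧
      ∀ v, (γ - β) (A v) = Complex.I * (γ - β) v := by
  let e := LinearEquiv.ofBijective (A - K) hbij
  let β : V →ₗ[ℝ] ℂ := (γ ∘ₗ A - Complex.I • γ) ∘ₗ e.symm.toLinearMap
  have h1 : ∀ k, β (A k - K k) = γ (A k) - Complex.I * γ k := by
    intro k
    have : e.symm (A k - K k) = k := e.symm_apply_apply k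
    change γ (A (e.symm _)) - Complex.I * γ (e.symm _) = _
    rw [this]
  have h2 : ∀ v, β (K v) = Complex.I * β v := by
    intro v
    obtain ⟨k, rfl⟩ := hbij.2 v
    have h3 : K ((A - K) k) = A (-A k) - K (-A k) := by
      simp only [LinearMap.sub_apply, map_sub, map_neg, hA, hK]
      abel
    rw [h3, h1, LinearMap.sub_apply, h1]
    simp only [map_neg, hA, neg_neg]
    linear_combination γ k * Complex.I_sq
  refine ⟨β, h1, h2, fun v => ?_⟩
  have h4 := h1 v
  rw [map_sub, h2] at h4
  simp only [LinearMap.sub_apply]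
  linear_combination -h4

end Decomposition

end ProjectiveDual

end

theorem propositionP (n : ℕ) (S : Set (ProjectiveDual.CP n))
    (hS : ProjectiveDual.IsStronglyCConvex S) :
    ∃ Jst : ∀ p : S, ProjectiveDual.H S p →ₗ[ℝ] ProjectiveDual.H S p,
      ProjectiveDual.IsProjectiveDualStructure S Jst ∧
      (∀ Jst', ProjectiveDual.IsProjectiveDualStructure S Jst' → Jst' = Jst) ∧
      ∃ d' d'' : ProjectiveDual.SmoothFunctions S →ₗ[ℂ] ProjectiveDual.HForms S,
        ∀ u : ProjectiveDual.SmoothFunctions S,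
          ProjectiveDual.IsDecomposition Jst u (d' u) (d'' u) ∧
          ∀ α β : ProjectiveDual.HForms S,
            ProjectiveDual.IsDecomposition Jst u α β → α = d' u ∧ β = d'' u := by
  open ProjectiveDual in
  choose K hK hK2 hbij using fun p : S => exists_isHessianAdjoint hS p.2
  have hdual := isProjectiveDualStructure_of_isHessianAdjoint hK hK2
  refine ⟨K, hdual, fun K' hK' => isProjectiveDualStructure_unique hS hdual hK', ?_⟩
  have hex : ∀ u : SmoothFunctions S, ∃ α β : HForms S, IsDecomposition K u α β := by
    intro u
    choose β hβ hβK hαJ using fun p : S =>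
      exists_dualPart JH_JH (hK2 p) (hbij p) (restrictedDifferential u p)
    have hβmem := dualPart_mem_HForms hS hK hbij u hβ
    refine ⟨⟨restrictedDifferential u, restrictedDifferential_mem_HForms hS.1 u⟩ - ⟨β, hβmem⟩,
      ⟨β, hβmem⟩, ?_, fun p v => hαJ p v, hβK⟩
    rw [isDifferentialOnH_iff hS.1, sub_add_cancel]
  have huniq : ∀ (u : SmoothFunctions S) (α β α' β' : HForms S), IsDecomposition K u α β →
      IsDecomposition K u α' β' → α = α' ∧ β = β' := by
    intro u α β α' β' h h'
    have hp := fun p : S => decomposition_unique (hbij p)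
      (congrFun (((isDifferentialOnH_iff hS.1 u _).1 h.1).trans
        ((isDifferentialOnH_iff hS.1 u _).1 h'.1).symm) p)
      (h.2.1 p) (h'.2.1 p) (h.2.2 p) (h'.2.2 p)
    exact ⟨Subtype.ext (funext fun p => (hp p).1), Subtype.ext (funext fun p => (hp p).2)⟩
  choose α β hαβ using hex
  have hadd : ∀ u v, IsDecomposition K (u + v) (α u + α v) (β u + β v) := by
    intro u v
    refine ⟨?_, fun p x => ?_, fun p x => ?_⟩
    · rw [isDifferentialOnH_iff hS.1, restrictedDifferential_add hS.1,
        ← (isDifferentialOnH_iff hS.1 u _).1 (hαβ u).1,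
        ← (isDifferentialOnH_iff hS.1 v _).1 (hαβ v).1, add_add_add_comm]
      rfl
    · have h1 := (hαβ u).2.1 p x
      have h2 := (hαβ v).2.1 p x
      change (α u).1 p _ + (α v).1 p _ = Complex.I * ((α u).1 p x + (α v).1 p x)
      rw [mul_add, ← h1, ← h2]
    · have h1 := (hαβ u).2.2 p x
      have h2 := (hαβ v).2.2 p x
      change (β u).1 p _ + (β v).1 p _ = Complex.I * ((β u).1 p x + (β v).1 p x)
      rw [mul_add, ← h1, ← h2]
  have hsmul : ∀ (c : ℂ) u, IsDecomposition K (c • u) (c • α u) (c • β u) := by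
    intro c u
    refine ⟨?_, fun p x => ?_, fun p x => ?_⟩
    · rw [isDifferentialOnH_iff hS.1, restrictedDifferential_smul hS.1,
        ← (isDifferentialOnH_iff hS.1 u _).1 (hαβ u).1, ← smul_add]
      rfl
    · have h1 := (hαβ u).2.1 p x
      change c * (α u).1 p _ = Complex.I * (c * (α u).1 p x)
      rw [mul_left_comm, ← h1]
    · have h1 := (hαβ u).2.2 p x
      change c * (β u).1 p _ = Complex.I * (c * (β u).1 p x)
      rw [mul_left_comm, ← h1]
  exact ⟨{ toFun := α
           map_add' := fun u v => (huniq _ _ _ _ _ (hαβ (u + v)) (hadd u v)).1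
           map_smul' := fun c u => (huniq _ _ _ _ _ (hαβ (c • u)) (hsmul c u)).1 },
    { toFun := β
      map_add' := fun u v => (huniq _ _ _ _ _ (hαβ (u + v)) (hadd u v)).2
      map_smul' := fun c u => (huniq _ _ _ _ _ (hαβ (c • u)) (hsmul c u)).2 },
    fun u => ⟨hαβ u, fun α' β' h => huniq u α' β' _ _ h (hαβ u)⟩⟩
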